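/- Let $\mathfrak{sl}_2=\operatorname{span}\{e,h,f\}$ with $[h,e]=2e$, $[e,f]=h$, $[h,f]=-2f$, Cartan subalgebra $\mathfrak h=\mathbb C h$, simple root $\alpha$, Weyl vector $\rho=\tfrac12\alpha$, root lattice $\mathsf Q=\mathbb Z\alpha$, form $\kappa(x,y)=\operatorname{tr}(xy)$, and let $(\cdot,\cdot)$ be the induced form on $\mathfrak h^*$, so that $(\alpha,\alpha)=2$. Let $\widehat{\mathfrak{sl}}_2=\mathfrak{sl}_2\otimes\mathbb C[t,t^{-1}]\oplus\mathbb CK\oplus\mathbb CL_0$, with $x_n=x\otimes t^n$, $K$ central, $[x_m,y_n]=[x,y]_{m+n}+m\,\delta_{m+n,0}\,\kappa(x,y)K$ and $[L_0,x_n]=-n\,x_n$. Fix a level $k\in\mathbb C$, a conformal weight $\Delta\in\mathbb C$ and $q\in\mathbb C$. For an $\mathfrak{sl}_2$-module $M$, the relaxed Verma module over $M$ is the $\widehat{\mathfrak{sl}}_2$-module induced from $M$, regarded as a module over the subalgebra spanned by $K$, $L_0$ and the $x_n$ with $n\ge 0$, on which $x_0$ acts as $x$, $x_n$ acts as $0$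 for $n>0$, $K$ acts as $k$ and $L_0$ acts as $\Delta$. * For $\lambda\in\mathfrak h^*/\mathsf Q$, let $\mathcal D_{\lambda;q}$ be the dense $\mathfrak{sl}_2$-module with basis $(v_\mu)_{\mu\in\lambda}$ and action $e v_\mu=\tfrac12\bigl[q-(\mu,\mu+2\rho)\bigr]v_{\mu+\alpha}$, $h v_\mu=(\mu,\alpha)v_\mu$, $f v_\mu=v_{\mu-\alpha}$. Let $\mathcal E_{\lambda;q}$ be the quotient of the relaxed Verma module over $\mathcal D_{\lambda;q}$ by the sum of all its submodules that meet the space of ground states $\mathcal D_{\lambda;q}$ in $0$. * For $\nu\in\mathfrak h^*$, let $\mathcal L^-_\nu$ be the simple quotient of the relaxed Verma module over the lowest-weight Verma $\mathfrak{sl}_2$-module of lowest weight $\nu$ (with the same $k$ and $\Delta$). * Let $\Lambda_q\subset\mathfrak h^*/\mathsf Q$ be the set of cosets that contain a solution $\mu$ of $(\mu,\mu+2\rho)=q$. For $\lambda\notin\Lambda_q$ the relaxed highest-weight module $\mathcal E_{\lambda;q}$ is simple. For a level-$k$ weight module $\mathcal M$ (with finite-dimensional weight spaces), let $\mathcal M(\nu,n)$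 be the weight space of $\mathfrak{sl}_2$-weight $\nu$ and $L_0$-weight $n$. The string functions of $\mathcal M$ are the generalised formal power series $\mathrm s_\nu[\mathcal M](\mathsf q)=\sum_{n\in\mathbb C}\dim\mathcal M(\nu,n)\,\mathsf q^n$, $\nu\in\mathfrak h^*$. If the weights of $\mathcal M$ lie in $[\mu]=\mu+\mathsf Q$, its positive limiting string function is $\mathrm s_\infty[\mathcal M]=\lim_{m\to\infty}\mathrm s_{\mu+m\alpha}[\mathcal M]$, the limit being taken coefficientwise, whenever it exists. **Theorem.** Let $\lambda\notin\Lambda_q$ and let $\mu\in\mathfrak h^*$ be a solution of $(\mu,\mu+2\rho)=q$; if $\sqrt{1+2q}\in\mathbb Z$, suppose moreover that $\mu$ is the maximal solution, with respect to the real part of $\mu(h)$. Then $\mathcal E_{\lambda;q}$ and $\mathcal L^-_{\mu+\alpha}$ have finite-dimensional weight spaces, $\mathrm s_\nu[\mathcal E_{\lambda;q}]\neq 0$ if and only if $\nu\in\lambda$, the positive limiting string function of $\mathcal L^-_{\mu+\alpha}$ exists, and $$\mathrm s_\nu[\mathcal E_{\lambda;q}](\mathsf q)=\mathrm s_\infty[\mathcal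 L^-_{\mu+\alpha}](\mathsf q)\qquad\text{for all }\nu\in\lambda .$$ -/

import Mathlib

open scoped TensorProduct
open LieAlgebra Filter Topology

attribute [local instance 100] LieRing.ofAssociativeRing

noncomputable section

namespace RelaxedSl2

/-! ### The Lie algebra `sl₂` -/

/-- The Lie algebra `sl₂` over `ℂ`, as trace-zero `2 × 2` matrices. -/
abbrev Sl2 : Type := LieAlgebra.SpecialLinear.sl (Fin 2) ℂ

/-- `e = E₁₂`. -/
def sl2e : Sl2 := ⟨!![0, 1; 0, 0], by
  simp [SpecialLinear.sl, LinearMap.mem_ker, Matrix.trace_fin_two]⟩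

/-- `h = E₁₁ - E₂₂`, spanning the Cartan subalgebra. -/
def sl2h : Sl2 := ⟨!![1, 0; 0, -1], by
  simp [SpecialLinear.sl, LinearMap.mem_ker, Matrix.trace_fin_two]⟩

/-- `f = E₂₁`. -/
def sl2f : Sl2 := ⟨!![0, 0; 1, 0], by
  simp [SpecialLinear.sl, LinearMap.mem_ker, Matrix.trace_fin_two]⟩

lemma sl2_trace (x : Sl2) : x.1 1 1 = - x.1 0 0 := by
  have h : Matrix.trace x.1 = 0 := x.2
  rw [Matrix.trace_fin_two] at h
  linear_combination h

lemma sl2_bracket (x y : Sl2) :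
    (⁅x, y⁆ : Sl2).1 = x.1 * y.1 - y.1 * x.1 := rfl

/-- The commutation relations `[h,e] = 2e`, `[e,f] = h`, `[h,f] = -2f`. -/
lemma sl2_relations :
    ⁅sl2h, sl2e⁆ = (2 : ℂ) • sl2e ∧ ⁅sl2e, sl2f⁆ = sl2h ∧ ⁅sl2h, sl2f⁆ = (-2 : ℂ) • sl2f := by
  refine ⟨?_, ?_, ?_⟩ <;> apply Subtype.ext <;> rw [sl2_bracket] <;> ext i j <;>
    fin_cases i <;> fin_cases j <;> simp [sl2e, sl2f, sl2h] <;> norm_num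

/-- The rescaled Killing form `κ(x,y) = tr(xy)`, with `κ(h,h) = 2` and `κ(e,f) = κ(f,e) = 1`. -/
def killing : LinearMap.BilinForm ℂ Sl2 :=
  LinearMap.mk₂ ℂ (fun x y => Matrix.trace (x.1 * y.1))
    (fun x x' y => by simp [add_mul]) (fun c x y => by simp)
    (fun x y y' => by simp [mul_add]) (fun c x y => by simp)

lemma killing_apply (x y : Sl2) : killing x y = Matrix.trace (x.1 * y.1) := rfl

lemma killing_isSymm : killing.IsSymm :=
  ⟨fun x y => by simp only [killing_apply]; exact Matrix.trace_mul_comm _ _⟩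

lemma killing_lieInvariant : killing.lieInvariant Sl2 := by
  intro x y z
  simp only [killing_apply, sl2_bracket, sub_mul, mul_sub, Matrix.trace_sub]
  rw [Matrix.mul_assoc x.1, Matrix.trace_mul_comm x.1 (y.1 * z.1), Matrix.mul_assoc,
    Matrix.mul_assoc]
  ring

/-- The representation of `sl₂` determined by operators `E`, `H`, `F` that satisfy the
commutation relations of `e`, `h`, `f`. -/
def sl2Rep {M : Type*} [AddCommGroup M] [Module ℂ M] (E H F : Module.End ℂ M)
    (hHE : H * E - E * H = (2 : ℂ) • E) (hEF : E * F - F * E = H)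
    (hHF : H * F - F * H = (-2 : ℂ) • F) : Sl2 →ₗ⁅ℂ⁆ Module.End ℂ M where
  toFun x := x.1 0 1 • E + x.1 0 0 • H + x.1 1 0 • F
  map_add' x y := by
    have h (i j : Fin 2) : (x + y).1 i j = x.1 i j + y.1 i j := rfl
    simp only [h, add_smul]; abel
  map_smul' c x := by
    have h (i j : Fin 2) : (c • x).1 i j = c * x.1 i j := rfl
    simp only [h, mul_smul, smul_add, RingHom.id_apply]
  map_lie' := by
    intro x y
    have e1 : (⁅x, y⁆ : Sl2).1 0 1 = 2 * (x.1 0 0 * y.1 0 1 - x.1 0 1 * y.1 0 0) := by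
      rw [sl2_bracket]
      simp only [Matrix.sub_apply, Matrix.mul_apply, Fin.sum_univ_two, sl2_trace]; ring
    have e2 : (⁅x, y⁆ : Sl2).1 0 0 = x.1 0 1 * y.1 1 0 - x.1 1 0 * y.1 0 1 := by
      rw [sl2_bracket]
      simp only [Matrix.sub_apply, Matrix.mul_apply, Fin.sum_univ_two]; ring
    have e3 : (⁅x, y⁆ : Sl2).1 1 0 = 2 * (x.1 1 0 * y.1 0 0 - x.1 0 0 * y.1 1 0) := by
      rw [sl2_bracket]
      simp only [Matrix.sub_apply, Matrix.mul_apply, Fin.sum_univ_two, sl2_trace]; ring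
    rw [e1, e2, e3, Ring.lie_def]
    have h1 : H * E = E * H + (2 : ℂ) • E := by rw [← hHE]; abel
    have h2 : E * F = F * E + H := eq_add_of_sub_eq' hEF
    have h3 : H * F = F * H + (-2 : ℂ) • F := by rw [← hHF]; abel
    simp only [mul_add, add_mul, smul_mul_assoc, mul_smul_comm, h1, h2, h3]
    module

/-! ### The affine Kac-Moody algebra -/

/-- The loop algebra `sl₂ ⊗ ℂ[t, t⁻¹]`. -/
def Loop : Type := LieAlgebra.loopAlgebra ℂ ℤ Sl2

instance : LieRing Loop := inferInstanceAs (LieRing (LieAlgebra.loopAlgebra ℂ ℤ Sl2))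

instance : LieAlgebra ℂ Loop := inferInstanceAs (LieAlgebra ℂ (LieAlgebra.loopAlgebra ℂ ℤ Sl2))

/-- A loop element as the family of its coefficients: `∑ xₙ ⊗ tⁿ ↦ (xₙ)`. -/
def loopCoeff : Loop ≃ₗ[ℂ] (ℤ →₀ Sl2) := LoopAlgebra.toFinsupp ℂ ℤ Sl2

/-- The loop element `x ⊗ tⁿ`. -/
def loopMode (x : Sl2) (n : ℤ) : Loop :=
  (AddMonoidAlgebra.single n (1 : ℂ) ⊗ₜ[ℂ] x : LieAlgebra.loopAlgebra ℂ ℤ Sl2)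

lemma loopCoeff_loopMode (x : Sl2) (n : ℤ) : loopCoeff (loopMode x n) = Finsupp.single n x :=
  LoopAlgebra.toFinsupp_single_tmul ℂ ℤ Sl2 n x

lemma loopMode_bracket (x y : Sl2) (m n : ℤ) :
    ⁅loopMode x m, loopMode y n⁆ = loopMode ⁅x, y⁆ (m + n) := by
  refine (LieAlgebra.ExtendScalars.bracket_tmul ℂ (AddMonoidAlgebra ℂ ℤ) Sl2 Sl2 _ _ _ _).trans ?_
  rw [AddMonoidAlgebra.single_mul_single, one_mul]
  rfl

lemma loop_induction {P : Loop → Prop} (h0 : P 0) (hadd : ∀ f g, P f → P g → P (f + g))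
    (hmode : ∀ x n, P (loopMode x n)) (f : Loop) : P f := by
  have key : ∀ F : ℤ →₀ Sl2, P (loopCoeff.symm F) := by
    intro F
    induction F using Finsupp.induction_linear with
    | zero => rw [map_zero]; exact h0
    | add F G hF hG => rw [map_add]; exact hadd _ _ hF hG
    | single n x => rw [← loopCoeff_loopMode, LinearEquiv.symm_apply_apply]; exact hmode x n
  simpa using key (loopCoeff f)

/-- The derivation `-t d/dt` of the loop algebra, `x ⊗ tⁿ ↦ -n (x ⊗ tⁿ)`. -/
def degDer : Loop →ₗ[ℂ] Loop :=
  loopCoeff.symm.toLinearMap ∘ₗ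
    (Finsupp.lsum ℂ fun n : ℤ => (-(n : ℂ)) • Finsupp.lsingle n) ∘ₗ loopCoeff.toLinearMap

lemma degDer_loopMode (x : Sl2) (n : ℤ) : degDer (loopMode x n) = (-(n : ℂ)) • loopMode x n := by
  rw [LinearEquiv.eq_symm_apply loopCoeff |>.mpr (loopCoeff_loopMode x n)]
  simp only [degDer, LinearMap.comp_apply, LinearEquiv.coe_coe, LinearEquiv.apply_symm_apply,
    Finsupp.lsum_apply]
  rw [Finsupp.sum_single_index (by simp), LinearMap.smul_apply, map_smul]
  rfl

/-- The bilinear form `ω(f, g) = Res κ(df, g)`, that is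
`ω(x ⊗ tᵐ, y ⊗ tⁿ) = m δ_{m+n,0} κ(x,y)`. -/
def loopCocycle (f g : Loop) : ℂ := LoopAlgebra.residuePairing ℂ ℤ Sl2 killing g f

lemma loopCocycle_loopMode (x y : Sl2) (m n : ℤ) :
    loopCocycle (loopMode x m) (loopMode y n) = if m + n = 0 then (m : ℂ) * killing x y else 0 := by
  have hk : killing y x = killing x y := killing_isSymm.eq _ _
  simp only [loopCocycle, loopMode, LoopAlgebra.residuePairing_apply_apply,
    LoopAlgebra.toFinsupp_single_tmul]
  rw [Finsupp.sum_single_index (by simp)]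
  by_cases h : m + n = 0
  · obtain rfl : n = -m := by omega
    simp [hk]
  · rw [if_neg h, Finsupp.single_eq_of_ne (by omega)]
    simp

lemma degDer_lie (f g : Loop) : degDer ⁅f, g⁆ = ⁅degDer f, g⁆ + ⁅f, degDer g⁆ := by
  induction f using loop_induction with
  | h0 => simp
  | hadd f f' hf hf' => simp only [add_lie, map_add, hf, hf']; abel
  | hmode x m =>
    induction g using loop_induction with
    | h0 => simp
    | hadd g g' hg hg' => simp only [lie_add, map_add, hg, hg']; abel
    | hmode y n =>
      rw [loopMode_bracket, degDer_loopMode, degDer_loopMode, degDer_loopMode, smul_lie, lie_smul,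
        loopMode_bracket]
      push_cast
      module

lemma loopCocycle_add_left (f f' g : Loop) :
    loopCocycle (f + f') g = loopCocycle f g + loopCocycle f' g :=
  map_add (LoopAlgebra.residuePairing ℂ ℤ Sl2 killing g) f f'

lemma loopCocycle_add_right (f g g' : Loop) :
    loopCocycle f (g + g') = loopCocycle f g + loopCocycle f g' :=
  LinearMap.map_add₂ (LoopAlgebra.residuePairing ℂ ℤ Sl2 killing) g g' f

lemma loopCocycle_smul_left (c : ℂ) (f g : Loop) :
    loopCocycle (c • f) g = c * loopCocycle f g :=
  map_smul (LoopAlgebra.residuePairing ℂ ℤ Sl2 killing g) c f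

lemma loopCocycle_smul_right (c : ℂ) (f g : Loop) :
    loopCocycle f (c • g) = c * loopCocycle f g :=
  LinearMap.map_smul₂ (LoopAlgebra.residuePairing ℂ ℤ Sl2 killing) c g f

lemma loopCocycle_zero_left (g : Loop) : loopCocycle 0 g = 0 :=
  map_zero (LoopAlgebra.residuePairing ℂ ℤ Sl2 killing g)

lemma loopCocycle_zero_right (f : Loop) : loopCocycle f 0 = 0 :=
  LinearMap.map_zero₂ (LoopAlgebra.residuePairing ℂ ℤ Sl2 killing) f

lemma loopCocycle_skew (f g : Loop) : loopCocycle f g = - loopCocycle g f := by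
  induction f using loop_induction with
  | h0 => simp [loopCocycle_zero_left, loopCocycle_zero_right]
  | hadd f f' hf hf' => rw [loopCocycle_add_left, loopCocycle_add_right, hf, hf']; ring
  | hmode x m =>
    induction g using loop_induction with
    | h0 => simp [loopCocycle_zero_left, loopCocycle_zero_right]
    | hadd g g' hg hg' => rw [loopCocycle_add_left, loopCocycle_add_right, hg, hg']; ring
    | hmode y n =>
      rw [loopCocycle_loopMode, loopCocycle_loopMode, add_comm n m, killing_isSymm.eq y x]
      split_ifs with h
      · obtain rfl : n = -m := by omega
        push_cast; ring
      · simp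

lemma loopCocycle_self (f : Loop) : loopCocycle f f = 0 := by
  have h := loopCocycle_skew f f
  linear_combination h / 2

lemma loopCocycle_degDer (f g : Loop) :
    loopCocycle (degDer f) g + loopCocycle f (degDer g) = 0 := by
  induction f using loop_induction with
  | h0 => simp [loopCocycle_zero_left]
  | hadd f f' hf hf' =>
    simp only [map_add, loopCocycle_add_left]
    linear_combination hf + hf'
  | hmode x m =>
    induction g using loop_induction with
    | h0 => simp [loopCocycle_zero_right]
    | hadd g g' hg hg' =>
      simp only [map_add, loopCocycle_add_right]
      linear_combination hg + hg'
    | hmode y n =>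
      rw [degDer_loopMode, degDer_loopMode, loopCocycle_smul_left, loopCocycle_smul_right,
        loopCocycle_loopMode]
      split_ifs with h
      · obtain rfl : n = -m := by omega
        push_cast; ring
      · simp

lemma loopCocycle_jacobi (f g k : Loop) :
    loopCocycle f ⁅g, k⁆ = loopCocycle ⁅f, g⁆ k + loopCocycle g ⁅f, k⁆ := by
  induction f using loop_induction with
  | h0 => simp [loopCocycle_zero_left, loopCocycle_zero_right]
  | hadd f f' hf hf' =>
    simp only [add_lie, loopCocycle_add_left, loopCocycle_add_right]
    linear_combination hf + hf'
  | hmode x m =>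
    induction g using loop_induction with
    | h0 => simp [loopCocycle_zero_left, loopCocycle_zero_right]
    | hadd g g' hg hg' =>
      simp only [add_lie, lie_add, loopCocycle_add_left, loopCocycle_add_right]
      linear_combination hg + hg'
    | hmode y n =>
      induction k using loop_induction with
      | h0 => simp [loopCocycle_zero_right]
      | hadd k k' hk hk' =>
        simp only [lie_add, loopCocycle_add_right]
        linear_combination hk + hk'
      | hmode z p =>
        simp only [loopMode_bracket, loopCocycle_loopMode]
        have h1 : killing ⁅x, y⁆ z = killing x ⁅y, z⁆ := by
          rw [← lie_skew, map_neg, LinearMap.neg_apply, killing_lieInvariant, neg_neg]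
        have h2 : killing y ⁅x, z⁆ = - killing x ⁅y, z⁆ := by
          rw [← h1, killing_lieInvariant, neg_neg]
        rw [h1, h2]
        by_cases h : m + n + p = 0
        · rw [if_pos (by omega), if_pos (by omega), if_pos (by omega)]
          push_cast; ring
        · rw [if_neg (by omega), if_neg (by omega), if_neg (by omega)]
          ring

/-- The untwisted affine Kac-Moody algebra `sl₂ ⊗ ℂ[t, t⁻¹] ⊕ ℂ K ⊕ ℂ L₀`; an element
`(x, a, b)` is `x + a K + b L₀`. -/
def AffineSl2 : Type := Loop × ℂ × ℂ

namespace AffineSl2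

instance : AddCommGroup AffineSl2 := inferInstanceAs (AddCommGroup (Loop × ℂ × ℂ))

instance : Module ℂ AffineSl2 := inferInstanceAs (Module ℂ (Loop × ℂ × ℂ))

/-- The component in the loop algebra. -/
def loop : AffineSl2 →ₗ[ℂ] Loop := LinearMap.fst ℂ Loop (ℂ × ℂ)

/-- The coefficient of `K`. -/
def coeffK : AffineSl2 →ₗ[ℂ] ℂ := LinearMap.fst ℂ ℂ ℂ ∘ₗ LinearMap.snd ℂ Loop (ℂ × ℂ)

/-- The coefficient of `L₀`. -/
def coeffL0 : AffineSl2 →ₗ[ℂ] ℂ := LinearMap.snd ℂ ℂ ℂ ∘ₗ LinearMap.snd ℂ Loop (ℂ × ℂ)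

/-- The element `f + a K + b L₀`. -/
def mk (f : Loop) (a b : ℂ) : AffineSl2 := (f, a, b)

@[simp] lemma loop_mk (f : Loop) (a b : ℂ) : loop (mk f a b) = f := rfl
@[simp] lemma coeffK_mk (f : Loop) (a b : ℂ) : coeffK (mk f a b) = a := rfl
@[simp] lemma coeffL0_mk (f : Loop) (a b : ℂ) : coeffL0 (mk f a b) = b := rfl

@[ext] lemma ext {X Y : AffineSl2} (h1 : loop X = loop Y) (h2 : coeffK X = coeffK Y)
    (h3 : coeffL0 X = coeffL0 Y) : X = Y :=
  Prod.ext h1 (Prod.ext h2 h3)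

/-- The bracket: `K` is central, `L₀` acts on the loop algebra as `-t d/dt`, and
`[x ⊗ tᵐ, y ⊗ tⁿ] = [x,y] ⊗ tᵐ⁺ⁿ + m δ_{m+n,0} κ(x,y) K`. -/
instance : Bracket AffineSl2 AffineSl2 where
  bracket X Y := mk (⁅loop X, loop Y⁆ + coeffL0 X • degDer (loop Y) - coeffL0 Y • degDer (loop X))
    (loopCocycle (loop X) (loop Y)) 0

@[simp] lemma loop_lie (X Y : AffineSl2) : loop ⁅X, Y⁆ =
    ⁅loop X, loop Y⁆ + coeffL0 X • degDer (loop Y) - coeffL0 Y • degDer (loop X) := rfl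
@[simp] lemma coeffK_lie (X Y : AffineSl2) : coeffK ⁅X, Y⁆ = loopCocycle (loop X) (loop Y) := rfl
@[simp] lemma coeffL0_lie (X Y : AffineSl2) : coeffL0 ⁅X, Y⁆ = 0 := rfl

instance : LieRing AffineSl2 where
  add_lie X Y Z := by
    ext <;> simp [loopCocycle_add_left]
    module
  lie_add X Y Z := by
    ext <;> simp [loopCocycle_add_right]
    module
  lie_self X := by
    ext <;> simp [loopCocycle_self]
  leibniz_lie X Y Z := by
    ext
    · simp only [loop_lie, coeffL0_lie, map_add, map_sub, map_smul, degDer_lie, lie_add, lie_sub,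
        add_lie, sub_lie, lie_smul, smul_lie, leibniz_lie (loop X) (loop Y) (loop Z)]
      rw [← lie_skew (degDer (loop X)) (loop Y)]
      module
    · rw [map_add]
      simp only [coeffK_lie, loop_lie, sub_eq_add_neg, ← neg_smul, loopCocycle_add_left,
        loopCocycle_add_right, loopCocycle_smul_left, loopCocycle_smul_right]
      have h1 := loopCocycle_jacobi (loop X) (loop Y) (loop Z)
      have h2 := loopCocycle_degDer (loop X) (loop Y)
      have h3 := loopCocycle_degDer (loop X) (loop Z)
      have h4 := loopCocycle_degDer (loop Y) (loop Z)
      have h5 := loopCocycle_skew (degDer (loop X)) (loop Y)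
      linear_combination h1 - coeffL0 Z * h2 + coeffL0 Y * h3 - coeffL0 X * h4 + coeffL0 Z * h5
    · simp

instance : LieAlgebra ℂ AffineSl2 where
  lie_smul c X Y := by
    ext
    · simp; module
    · simp [loopCocycle_smul_right]
    · simp

/-- The mode `xₙ = x ⊗ tⁿ`. -/
def mode (x : Sl2) (n : ℤ) : AffineSl2 := mk (loopMode x n) 0 0

/-- The central element `K`. -/
def K : AffineSl2 := mk 0 1 0

/-- The grading element `L₀`. -/
def L0 : AffineSl2 := mk 0 0 1

lemma mode_lie_mode (x y : Sl2) (m n : ℤ) : ⁅mode x m, mode y n⁆ =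
    mode ⁅x, y⁆ (m + n) + (if m + n = 0 then (m : ℂ) * killing x y else 0) • K := by
  ext <;> simp [mode, K, loopMode_bracket, loopCocycle_loopMode, -ite_smul]

lemma K_lie (X : AffineSl2) : ⁅K, X⁆ = 0 := by
  ext <;> simp [K, loopCocycle_zero_left]

lemma L0_lie_mode (x : Sl2) (n : ℤ) : ⁅L0, mode x n⁆ = (-(n : ℂ)) • mode x n := by
  ext <;> simp [mode, L0, degDer_loopMode, loopCocycle_zero_left]

lemma lie_K (X : AffineSl2) : ⁅X, K⁆ = 0 := by rw [← lie_skew, K_lie, neg_zero]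

lemma mode_lie_L0 (x : Sl2) (n : ℤ) : ⁅mode x n, L0⁆ = (n : ℂ) • mode x n := by
  rw [← lie_skew, L0_lie_mode]; module

/-- Spanning set of the non-negative part: `K`, `L₀` and the modes `xₙ` with `n ≥ 0`. -/
def nonnegGens : Set AffineSl2 := {X | X = K ∨ X = L0 ∨ ∃ (x : Sl2) (n : ℕ), X = mode x n}

/-- The subalgebra spanned by `K`, `L₀` and the modes `xₙ` with `x ∈ sl₂` and `n ≥ 0`. -/
def nonneg : LieSubalgebra ℂ AffineSl2 :=
  { Submodule.span ℂ nonnegGens with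
    lie_mem' := by
      intro X Y hX hY
      change X ∈ Submodule.span ℂ nonnegGens at hX
      change Y ∈ Submodule.span ℂ nonnegGens at hY
      change ⁅X, Y⁆ ∈ Submodule.span ℂ nonnegGens
      have hK : K ∈ Submodule.span ℂ nonnegGens := Submodule.subset_span (Or.inl rfl)
      have hm (x : Sl2) (n : ℕ) : mode x n ∈ Submodule.span ℂ nonnegGens :=
        Submodule.subset_span (Or.inr (Or.inr ⟨x, n, rfl⟩))
      induction hX using Submodule.span_induction with
      | zero => rw [zero_lie]; exact Submodule.zero_mem _
      | add X X' _ _ h h' => rw [add_lie]; exact Submodule.add_mem _ h h'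
      | smul c X _ h => rw [smul_lie]; exact Submodule.smul_mem _ c h
      | mem X hX =>
        induction hY using Submodule.span_induction with
        | zero => rw [lie_zero]; exact Submodule.zero_mem _
        | add Y Y' _ _ h h' => rw [lie_add]; exact Submodule.add_mem _ h h'
        | smul c Y _ h => rw [lie_smul]; exact Submodule.smul_mem _ c h
        | mem Y hY =>
          obtain rfl | rfl | ⟨x, m, rfl⟩ := hX
          · rw [K_lie]; exact Submodule.zero_mem _
          · obtain rfl | rfl | ⟨y, n, rfl⟩ := hY
            · rw [lie_K]; exact Submodule.zero_mem _
            · rw [lie_self]; exact Submodule.zero_mem _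
            · rw [L0_lie_mode]; exact Submodule.smul_mem _ _ (hm y n)
          · obtain rfl | rfl | ⟨y, n, rfl⟩ := hY
            · rw [lie_K]; exact Submodule.zero_mem _
            · rw [mode_lie_L0]; exact Submodule.smul_mem _ _ (hm x m)
            · rw [mode_lie_mode]
              exact Submodule.add_mem _ (by exact_mod_cast hm ⁅x, y⁆ (m + n))
                (Submodule.smul_mem _ _ hK) }

/-- The zero mode `x₀` coefficient of an element of the affine algebra. -/
def zeroMode : AffineSl2 →ₗ[ℂ] Sl2 :=
  Finsupp.lapply 0 ∘ₗ loopCoeff.toLinearMap ∘ₗ loop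

lemma zeroMode_mode (x : Sl2) (n : ℤ) : zeroMode (mode x n) = if n = 0 then x else 0 := by
  simp [zeroMode, mode, loopCoeff_loopMode, Finsupp.single_apply]

lemma zeroMode_K : zeroMode K = 0 := by simp [zeroMode, K]

lemma zeroMode_L0 : zeroMode L0 = 0 := by simp [zeroMode, L0]

end AffineSl2

open AffineSl2

section Ground

variable {M : Type*} [AddCommGroup M] [Module ℂ M]

/-- The linear map underlying `groundRep`. -/
def groundMap (k Δ : ℂ) (π : Sl2 →ₗ⁅ℂ⁆ Module.End ℂ M) : AffineSl2 →ₗ[ℂ] Module.End ℂ M :=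
  (π : Sl2 →ₗ[ℂ] Module.End ℂ M) ∘ₗ zeroMode +
    (k • coeffK + Δ • coeffL0).smulRight (1 : Module.End ℂ M)

lemma groundMap_K (k Δ : ℂ) (π : Sl2 →ₗ⁅ℂ⁆ Module.End ℂ M) : groundMap k Δ π K = k • 1 := by
  simp [groundMap, zeroMode_K]; simp [K]

lemma groundMap_L0 (k Δ : ℂ) (π : Sl2 →ₗ⁅ℂ⁆ Module.End ℂ M) : groundMap k Δ π L0 = Δ • 1 := by
  simp [groundMap, zeroMode_L0]; simp [L0]

lemma groundMap_mode (k Δ : ℂ) (π : Sl2 →ₗ⁅ℂ⁆ Module.End ℂ M) (x : Sl2) (n : ℤ) :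
    groundMap k Δ π (mode x n) = if n = 0 then π x else 0 := by
  simp only [groundMap, LinearMap.add_apply, LinearMap.comp_apply, zeroMode_mode]
  split_ifs <;> simp [mode]

lemma groundMap_lie (k Δ : ℂ) (π : Sl2 →ₗ⁅ℂ⁆ Module.End ℂ M) (X Y : AffineSl2) (hX : X ∈ nonneg)
    (hY : Y ∈ nonneg) : groundMap k Δ π ⁅X, Y⁆ = ⁅groundMap k Δ π X, groundMap k Δ π Y⁆ := by
  change X ∈ Submodule.span ℂ nonnegGens at hX
  change Y ∈ Submodule.span ℂ nonnegGens at hY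
  induction hX using Submodule.span_induction with
  | zero => simp
  | add X X' _ _ h h' => simp only [add_lie, map_add, h, h']
  | smul c X _ h => simp only [smul_lie, map_smul, h]
  | mem X hX =>
    induction hY using Submodule.span_induction with
    | zero => simp
    | add Y Y' _ _ h h' => simp only [lie_add, map_add, h, h']
    | smul c Y _ h => simp only [lie_smul, map_smul, h]
    | mem Y hY =>
      have h1 (c : ℂ) (A : Module.End ℂ M) : ⁅c • (1 : Module.End ℂ M), A⁆ = 0 := by
        rw [Ring.lie_def]; simp
      have h2 (c : ℂ) (A : Module.End ℂ M) : ⁅A, c • (1 : Module.End ℂ M)⁆ = 0 := by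
        rw [Ring.lie_def]; simp
      obtain rfl | rfl | ⟨x, m, rfl⟩ := hX
      · rw [K_lie, groundMap_K, h1, map_zero]
      · obtain rfl | rfl | ⟨y, n, rfl⟩ := hY
        · rw [lie_K, groundMap_K, h2, map_zero]
        · rw [lie_self, lie_self, map_zero]
        · rw [L0_lie_mode, groundMap_L0, h1, map_smul, groundMap_mode]
          split_ifs with h <;> simp [h]
      · obtain rfl | rfl | ⟨y, n, rfl⟩ := hY
        · rw [lie_K, groundMap_K, h2, map_zero]
        · rw [mode_lie_L0, groundMap_L0, h2, map_smul, groundMap_mode]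
          split_ifs with h <;> simp [h]
        · rw [mode_lie_mode, map_add, map_smul, groundMap_mode, groundMap_mode, groundMap_mode]
          by_cases hm : m = 0
          · by_cases hn : n = 0 <;> simp [hm, hn]
          · rw [if_neg (by omega), if_neg (by omega), if_neg (by omega)]
            simp

/-- The extension of an `sl₂`-module `M` to a module over the non-negative subalgebra: the zero
modes `x₀` act as `x`, `K` acts as the level `k`, `L₀` acts as the conformal weight `Δ` and the
modes `xₙ` with `n > 0` act as `0`. -/
def groundRep (k Δ : ℂ) (π : Sl2 →ₗ⁅ℂ⁆ Module.End ℂ M) : nonneg →ₗ⁅ℂ⁆ Module.End ℂ M :=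
  { (groundMap k Δ π).domRestrict nonneg.toSubmodule with
    map_lie' := fun {X Y} => groundMap_lie k Δ π X.1 Y.1 X.2 Y.2 }

end Ground

/-! ### Induced modules -/

section Induced

variable {L : Type*} [LieRing L] [LieAlgebra ℂ L] (H : LieSubalgebra ℂ L)
  {M : Type*} [AddCommGroup M] [Module ℂ M] (ρ : H →ₗ⁅ℂ⁆ Module.End ℂ M)

/-- The relations `u a ⊗ m = u ⊗ a m`, for `a` in the subalgebra `H`. -/
def inducedRelations : Submodule (UniversalEnvelopingAlgebra ℂ L)
    (UniversalEnvelopingAlgebra ℂ L ⊗[ℂ] M) :=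
  Submodule.span (UniversalEnvelopingAlgebra ℂ L)
    {z | ∃ (u : UniversalEnvelopingAlgebra ℂ L) (a : H) (m : M),
      z = (u * UniversalEnvelopingAlgebra.ι ℂ (a : L)) ⊗ₜ[ℂ] m - u ⊗ₜ[ℂ] (ρ a m)}

/-- The induced module `U(L) ⊗_{U(H)} M`, as a left `U(L)`-module. The relations are imposed for
elements of `H` only, which is enough as these generate `U(H)`. -/
abbrev Induced : Type _ :=
  (UniversalEnvelopingAlgebra ℂ L ⊗[ℂ] M) ⧸ inducedRelations H ρ

/-- The canonical map `M → U(L) ⊗_{U(H)} M`, `m ↦ 1 ⊗ m`. -/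
def inducedMk : M →ₗ[ℂ] Induced H ρ :=
  ((inducedRelations H ρ).mkQ.restrictScalars ℂ) ∘ₗ
    TensorProduct.mk ℂ (UniversalEnvelopingAlgebra ℂ L) M 1

end Induced

/-- The universal enveloping algebra of the affine algebra. -/
abbrev UAffine : Type := UniversalEnvelopingAlgebra ℂ AffineSl2

section Modules

variable {M : Type*} [AddCommGroup M] [Module ℂ M]

/-- The relaxed Verma module of level `k` induced from an `sl₂`-module `M` (with action `π`) of
conformal weight `Δ`. -/
abbrev RelaxedVerma (k Δ : ℂ) (π : Sl2 →ₗ⁅ℂ⁆ Module.End ℂ M) : Type _ :=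
  Induced nonneg (groundRep k Δ π)

/-- The space `1 ⊗ M` of ground states of a relaxed Verma module. -/
def groundStates (k Δ : ℂ) (π : Sl2 →ₗ⁅ℂ⁆ Module.End ℂ M) :
    Submodule ℂ (RelaxedVerma k Δ π) :=
  LinearMap.range (inducedMk nonneg (groundRep k Δ π))

/-- The sum of the submodules of a relaxed Verma module that have zero intersection with the space
of ground states. -/
def maxAvoidingGround (k Δ : ℂ) (π : Sl2 →ₗ⁅ℂ⁆ Module.End ℂ M) :
    Submodule UAffine (RelaxedVerma k Δ π) :=
  sSup {N | N.restrictScalars ℂ ⊓ groundStates k Δ π = ⊥}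

/-- The sum of the proper submodules of a relaxed Verma module. If the module is generated by a
weight vector whose weight space is one-dimensional, then this is its maximal proper submodule. -/
def maxProper (k Δ : ℂ) (π : Sl2 →ₗ⁅ℂ⁆ Module.End ℂ M) :
    Submodule UAffine (RelaxedVerma k Δ π) :=
  sSup {N | N ≠ ⊤}

end Modules

/-! ### Weights -/

/-- A weight `ν ∈ 𝔥*` of `sl₂`, identified with its Dynkin label `ν(h) ∈ ℂ`. -/
abbrev Weight : Type := ℂ

/-- The simple root `α`, with `α(h) = 2`. -/
def simpleRoot : Weight := 2

/-- The Weyl vector `ρ`, half of the simple root. -/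
def weylVector : Weight := 1

/-- The bilinear form on `𝔥*` induced from `κ`, normalised by `(α, α) = 2`. -/
def bilin (μ ν : Weight) : ℂ := μ * ν / 2

/-- `(μ, ν) = κ(t_μ, t_ν)`, where `t_μ = (μ(h)/2) h` satisfies `κ(t_μ, h) = μ(h)`. -/
lemma bilin_eq_killing (μ ν : Weight) :
    killing ((μ / 2) • sl2h) sl2h = μ ∧
      bilin μ ν = killing ((μ / 2) • sl2h) ((ν / 2) • sl2h) := by
  have h : killing sl2h sl2h = 2 := by
    rw [killing_apply, Matrix.trace_fin_two]
    simp [sl2h, Matrix.mul_apply]; norm_num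
  constructor
  · rw [LinearMap.map_smul₂, h, smul_eq_mul]; ring
  · rw [LinearMap.map_smul₂, map_smul, h, smul_eq_mul, smul_eq_mul, bilin]; ring

/-- The root lattice `ℤ α`. -/
def rootLattice : AddSubgroup Weight := AddSubgroup.zmultiples simpleRoot

/-- The set `Λ_q` of the cosets in `𝔥* / ℤ α` that contain a solution `μ` of
`(μ, μ + 2ρ) = q`. -/
def nonsimpleSet (q : ℂ) : Set (Weight ⧸ rootLattice) :=
  {lam | ∃ μ : Weight, (μ : Weight ⧸ rootLattice) = lam ∧ bilin μ (μ + 2 * weylVector) = q}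

lemma coset_add_simpleRoot (μ : Weight) :
    ((μ + simpleRoot : Weight) : Weight ⧸ rootLattice) = (μ : Weight ⧸ rootLattice) :=
  QuotientAddGroup.mk_add_of_mem μ (AddSubgroup.mem_zmultiples simpleRoot)

lemma coset_sub_simpleRoot (μ : Weight) :
    ((μ - simpleRoot : Weight) : Weight ⧸ rootLattice) = (μ : Weight ⧸ rootLattice) := by
  rw [← coset_add_simpleRoot (μ - simpleRoot), sub_add_cancel]

/-! ### Dense `sl₂`-modules -/

/-- The weights in a coset. -/
abbrev CosetWeight (lam : Weight ⧸ rootLattice) : Type :=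
  {μ : Weight // (μ : Weight ⧸ rootLattice) = lam}

/-- The space of the dense module, with basis `v_μ`, `μ ∈ lam`. -/
abbrev DenseSpace (lam : Weight ⧸ rootLattice) : Type := CosetWeight lam →₀ ℂ

/-- `μ ↦ μ + α`. -/
def CosetWeight.up {lam : Weight ⧸ rootLattice} (μ : CosetWeight lam) : CosetWeight lam :=
  ⟨μ.1 + simpleRoot, (coset_add_simpleRoot μ.1).trans μ.2⟩

/-- `μ ↦ μ - α`. -/
def CosetWeight.down {lam : Weight ⧸ rootLattice} (μ : CosetWeight lam) : CosetWeight lam :=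
  ⟨μ.1 - simpleRoot, (coset_sub_simpleRoot μ.1).trans μ.2⟩

/-- `γ_μ = ½ (q - (μ, μ + 2ρ))`. -/
def denseCoeff (q : ℂ) (μ : Weight) : ℂ := (q - bilin μ (μ + 2 * weylVector)) / 2

/-- `e v_μ = γ_μ v_{μ+α}`. -/
def denseE (lam : Weight ⧸ rootLattice) (q : ℂ) : Module.End ℂ (DenseSpace lam) :=
  Finsupp.linearCombination ℂ fun μ => denseCoeff q μ.1 • Finsupp.single μ.up (1 : ℂ)

/-- `h v_μ = (μ, α) v_μ`. -/
def denseH (lam : Weight ⧸ rootLattice) : Module.End ℂ (DenseSpace lam) :=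
  Finsupp.linearCombination ℂ fun μ => bilin μ.1 simpleRoot • Finsupp.single μ (1 : ℂ)

/-- `f v_μ = v_{μ-α}`. -/
def denseF (lam : Weight ⧸ rootLattice) : Module.End ℂ (DenseSpace lam) :=
  Finsupp.linearCombination ℂ fun μ => Finsupp.single μ.down (1 : ℂ)

/-- The dense `sl₂`-module with weight support `lam`, on which the Casimir
`½ h² + ef + fe` acts as `q` and `f` acts injectively. -/
def denseRep (lam : Weight ⧸ rootLattice) (q : ℂ) : Sl2 →ₗ⁅ℂ⁆ Module.End ℂ (DenseSpace lam) :=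
  sl2Rep (denseE lam q) (denseH lam) (denseF lam)
    (by
      ext1 μ; ext1
      simp only [LinearMap.comp_apply, LinearMap.sub_apply, LinearMap.smul_apply,
        Module.End.mul_apply, denseE, denseH, Finsupp.lsingle_apply,
        Finsupp.linearCombination_single, one_smul, map_smul, smul_smul, ← sub_smul]
      congr 1
      simp only [CosetWeight.up, bilin, simpleRoot]
      ring)
    (by
      ext1 μ; ext1
      have h1 : μ.down.up = μ := Subtype.ext (sub_add_cancel _ _)
      have h2 : μ.up.down = μ := Subtype.ext (add_sub_cancel_right _ _)
      simp only [LinearMap.comp_apply, LinearMap.sub_apply, LinearMap.smul_apply,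
        Module.End.mul_apply, denseE, denseF, denseH, Finsupp.lsingle_apply,
        Finsupp.linearCombination_single, one_smul, map_smul, smul_smul, ← sub_smul, h1, h2]
      congr 1
      simp only [CosetWeight.down, denseCoeff, bilin, simpleRoot, weylVector]
      ring)
    (by
      ext1 μ; ext1
      simp only [LinearMap.comp_apply, LinearMap.sub_apply, LinearMap.smul_apply,
        Module.End.mul_apply, denseF, denseH, Finsupp.lsingle_apply,
        Finsupp.linearCombination_single, one_smul, map_smul, smul_smul, ← sub_smul]
      congr 1
      simp only [CosetWeight.down, bilin, simpleRoot]
      ring)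

/-! ### Lowest-weight Verma `sl₂`-modules -/

/-- The space of the lowest-weight Verma module, with basis `wₙ = eⁿ w₀`. -/
abbrev LowestVermaSpace : Type := ℕ →₀ ℂ

/-- `e wₙ = wₙ₊₁`. -/
def lowestE : Module.End ℂ LowestVermaSpace :=
  Finsupp.linearCombination ℂ fun n => Finsupp.single (n + 1) (1 : ℂ)

/-- `h wₙ = (ν + nα)(h) wₙ`. -/
def lowestH (ν : Weight) : Module.End ℂ LowestVermaSpace :=
  Finsupp.linearCombination ℂ fun n => (ν + n * simpleRoot) • Finsupp.single n (1 : ℂ)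

/-- `f w₀ = 0` and `f wₙ = -n (ν(h) + n - 1) wₙ₋₁`. -/
def lowestF (ν : Weight) : Module.End ℂ LowestVermaSpace :=
  Finsupp.linearCombination ℂ fun n =>
    (-(n : ℂ) * (ν + n - 1)) • Finsupp.single (n - 1) (1 : ℂ)

/-- The lowest-weight Verma `sl₂`-module of lowest weight `ν`. -/
def lowestVermaRep (ν : Weight) : Sl2 →ₗ⁅ℂ⁆ Module.End ℂ LowestVermaSpace :=
  sl2Rep lowestE (lowestH ν) (lowestF ν)
    (by
      ext1 n; ext1
      simp only [LinearMap.comp_apply, LinearMap.sub_apply, LinearMap.smul_apply,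
        Module.End.mul_apply, lowestE, lowestH, Finsupp.lsingle_apply,
        Finsupp.linearCombination_single, one_smul, map_smul, smul_smul, ← sub_smul]
      congr 1
      simp only [simpleRoot]
      push_cast
      ring)
    (by
      ext1 n; ext1
      cases n with
      | zero => simp [lowestE, lowestH, lowestF, -Finsupp.single_mul]
      | succ n =>
        simp only [LinearMap.comp_apply, LinearMap.sub_apply, LinearMap.smul_apply,
          Module.End.mul_apply, lowestE, lowestH, lowestF, Finsupp.lsingle_apply,
          Finsupp.linearCombination_single, one_smul, map_smul, smul_smul, ← sub_smul, Nat.add_sub_cancel]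
        congr 1
        simp only [simpleRoot]
        push_cast
        ring)
    (by
      ext1 n; ext1
      cases n with
      | zero => simp [lowestH, lowestF]
      | succ n =>
        simp only [LinearMap.comp_apply, LinearMap.sub_apply, LinearMap.smul_apply,
          Module.End.mul_apply, lowestH, lowestF, Finsupp.lsingle_apply,
          Finsupp.linearCombination_single, one_smul, map_smul, smul_smul, ← sub_smul, Nat.add_sub_cancel]
        congr 1
        simp only [simpleRoot]
        push_cast
        ring)

/-! ### The affine modules -/

/-- The relaxed highest-weight module `E_{lam;q}` of level `k` and conformal weight `Δ`: the quotient of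
the relaxed Verma module induced from the dense module `D_{lam;q}` by the sum of the submodules
having zero intersection with the space of ground states. -/
abbrev RelaxedModule (k Δ : ℂ) (lam : Weight ⧸ rootLattice) (q : ℂ) : Type :=
  RelaxedVerma k Δ (denseRep lam q) ⧸ maxAvoidingGround k Δ (denseRep lam q)

/-- The simple quotient `L⁻_ν`, by the maximal proper submodule, of the affine Verma module `V⁻_ν` of
level `k` and conformal weight `Δ` induced from the lowest-weight Verma `sl₂`-module of lowest
weight `ν`. -/
abbrev SimpleLowest (k Δ : ℂ) (ν : Weight) : Type :=
  RelaxedVerma k Δ (lowestVermaRep ν) ⧸ maxProper k Δ (lowestVermaRep ν)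

/-! ### String functions -/

section Strings

variable (M : Type*) [AddCommGroup M] [Module ℂ M] [Module UAffine M] [IsScalarTower ℂ UAffine M]

/-- The action of an element of the affine algebra on a module. -/
def act (X : AffineSl2) : Module.End ℂ M :=
  Algebra.lsmul ℂ ℂ M (UniversalEnvelopingAlgebra.ι ℂ X)

/-- The weight space `M(μ, n)`: the vectors of `sl₂`-weight `μ` and conformal weight `n`, that is
the simultaneous generalised eigenspace of `h₀` and `L₀` (the central element `K` acts as the
level throughout). -/
def weightSpace (μ : Weight) (n : ℂ) : Submodule ℂ M :=
  (act M (mode sl2h 0)).maxGenEigenspace μ ⊓ (act M L0).maxGenEigenspace n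

/-- The coefficients of the string function `s_μ[M] = ∑ₙ dim M(μ, n) qⁿ`, `n ∈ ℂ`. -/
def stringFunction (μ : Weight) : ℂ → ℕ := fun n => Module.finrank ℂ (weightSpace M μ n)

/-- `S` is the positive limiting string function of a module whose weights lie in the coset of `μ`:
the coefficients of `s_{μ+mα}[M]` converge to those of `S` as `m → ∞`. -/
def IsPositiveLimit (μ : Weight) (S : ℂ → ℕ) : Prop :=
  ∀ n : ℂ, Tendsto (fun m : ℤ => stringFunction M (μ + m * simpleRoot) n) atTop (𝓝 (S n))

end Strings

end RelaxedSl2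

end

noncomputable section

namespace RelaxedSl2

/-! ### Enveloping algebras and induced modules -/

section Enveloping

variable {L : Type*} [LieRing L] [LieAlgebra ℂ L]

open UniversalEnvelopingAlgebra (ι)

/-! Both modules are quotients of relaxed Verma modules by the largest submodule avoiding the ground
states. For the lowest-weight module this uses that maximality of `μ` makes the inducing `sl₂`-Verma
module irreducible (`add_natCast_ne_zero`, `lowestVermaRep_irreducible`, `maxProper_eq`). That
submodule is the radical `groundKer` of a pairing: `v` lies in it exactly when `u • v` has zero
ground component for every `u` in the enveloping algebra. A weight multiplicity is therefore the
rank of a matrix whose rows are words of degree `d` in the negative modes and whose columns are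
pairs of an element `u` and a ground coordinate.

After rescaling a basis, the lowest-weight Verma module satisfies the same formulas as a dense
module with the same `q` (`WeightChain`). Hence, for fixed `k`, `Δ`, `q`, the matrix entries of both
modules are values of the same polynomials in the weight, computed once over `ℂ[X]` (`univRep`,
`pairing`) and then specialised. Let `r` be the generic rank in degree `d`, and fix an `r × r` minor
that is a nonzero polynomial (`exists_generic_rank`). Multiplicities never exceed `r`, and they
equal `r` wherever the minor is nonzero and the ground vectors read off by its columns can be
separated by functionals.

The minor has finitely many zeros along a coset. Far in the direction of `α` both conditions hold
for the lowest-weight module, so its multiplicities stabilise at `r`. In the dense case some weight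
of `lam` has multiplicity `r`. Since `lam` avoids the zeros of `γ`, `e` and `f` are injective on the
ground states; an Ore-type argument (`exists_pow_mul`) lifts this to the affine quotient, and
multiplicities are constant along `lam`.

The ground component is well defined because the affine algebra acts on `U(negative) ⊗ M`; this
action is constructed directly (`triangularMap_lie`), without a PBW theorem. -/

lemma adjoin_range_ι :
    Algebra.adjoin ℂ (Set.range (ι ℂ : L → UniversalEnvelopingAlgebra ℂ L)) = ⊤ := by
  set S := Algebra.adjoin ℂ (Set.range (ι ℂ : L → UniversalEnvelopingAlgebra ℂ L)) with hS
  let j : L →ₗ⁅ℂ⁆ S :=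
    { toFun := fun x => ⟨ι ℂ x, Algebra.subset_adjoin ⟨x, rfl⟩⟩
      map_add' := fun x y => Subtype.ext (map_add _ x y)
      map_smul' := fun c x => Subtype.ext (map_smul _ c x)
      map_lie' := fun {x y} => Subtype.ext (LieHom.map_lie (ι ℂ) x y) }
  -- By the universal property the identity factors through `S`, so `S` is everything.
  have h : S.val.comp (UniversalEnvelopingAlgebra.lift ℂ j) = AlgHom.id ℂ _ := by
    apply UniversalEnvelopingAlgebra.hom_ext
    ext x
    simp only [LieHom.comp_apply, AlgHom.coe_toLieHom, AlgHom.comp_apply, AlgHom.id_apply]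
    rw [UniversalEnvelopingAlgebra.lift_ι_apply]
    rfl
  rw [eq_top_iff]
  intro u _
  have := congrArg (fun f => f u) h
  simp only [AlgHom.comp_apply, AlgHom.id_apply] at this
  rw [← this]
  exact (UniversalEnvelopingAlgebra.lift ℂ j u).2

/-- The enveloping algebra is spanned by the words in elements of the Lie algebra. -/
theorem enveloping_induction {C : UniversalEnvelopingAlgebra ℂ L → Prop}
    (one : C 1) (add : ∀ u v, C u → C v → C (u + v)) (smul : ∀ (c : ℂ) u, C u → C (c • u))
    (mul : ∀ x u, C u → C (ι ℂ x * u)) (u : UniversalEnvelopingAlgebra ℂ L) : C u := by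
  have hu : u ∈ Algebra.adjoin ℂ (Set.range (ι ℂ : L → UniversalEnvelopingAlgebra ℂ L)) := by
    rw [adjoin_range_ι]; trivial
  rw [← Subalgebra.mem_toSubmodule, Algebra.adjoin_eq_span] at hu
  induction hu using Submodule.span_induction with
  | zero => simpa using smul 0 _ one
  | add u v _ _ h h' => exact add _ _ h h'
  | smul c u _ h => exact smul _ _ h
  | mem u hu =>
    induction hu using Submonoid.closure_induction_left with
    | one => exact one
    | mul_left x hx y _ h =>
      obtain ⟨x, rfl⟩ := hx
      exact mul _ _ h

section Lift

variable {H : LieSubalgebra ℂ L} {M : Type*} [AddCommGroup M] [Module ℂ M]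
  {ρ : H →ₗ⁅ℂ⁆ Module.End ℂ M} {W : Type*} [AddCommGroup W] [Module ℂ W]

/-- Frobenius reciprocity: a map `g : M → W` into a representation `δ` of `U(L)`, compatible with
the actions of `H`, extends to the induced module. -/
def inducedLift (δ : UniversalEnvelopingAlgebra ℂ L →ₐ[ℂ] Module.End ℂ W) (g : M →ₗ[ℂ] W)
    (hg : ∀ (a : H) (m : M), g (ρ a m) = δ (ι ℂ (a : L)) (g m)) : Induced H ρ →ₗ[ℂ] W :=
  (inducedRelations H ρ).restrictScalars ℂ |>.liftQ
    (TensorProduct.lift (LinearMap.flip (LinearMap.flip δ.toLinearMap ∘ₗ g))) (by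
      set T := TensorProduct.lift (LinearMap.flip (LinearMap.flip δ.toLinearMap ∘ₗ g)) with hT
      have hTu (u m) : T (u ⊗ₜ m) = δ u (g m) := by simp [hT]
      have hTs (u z) : T (u • z) = δ u (T z) := by
        induction z using TensorProduct.induction_on with
        | zero => simp
        | add x y hx hy => simp [smul_add, hx, hy]
        | tmul v m => rw [TensorProduct.smul_tmul', hTu, hTu]; simp
      intro z hz
      rw [Submodule.restrictScalars_mem] at hz
      rw [LinearMap.mem_ker]
      induction hz using Submodule.span_induction with
      | zero => simp
      | add x y _ _ hx hy => simp [hx, hy]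
      | smul u z _ hz => rw [hTs, hz, map_zero]
      | mem z hz =>
        obtain ⟨u, a, m, rfl⟩ := hz
        rw [map_sub, hTu, hTu, hg, map_mul]
        simp)

lemma inducedLift_mk (δ : UniversalEnvelopingAlgebra ℂ L →ₐ[ℂ] Module.End ℂ W) (g : M →ₗ[ℂ] W)
    (hg : ∀ (a : H) (m : M), g (ρ a m) = δ (ι ℂ (a : L)) (g m)) (m : M) :
    inducedLift δ g hg (inducedMk H ρ m) = g m := by
  change TensorProduct.lift (LinearMap.flip (LinearMap.flip δ.toLinearMap ∘ₗ g)) (1 ⊗ₜ m) = _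
  simp

lemma inducedLift_smul (δ : UniversalEnvelopingAlgebra ℂ L →ₐ[ℂ] Module.End ℂ W) (g : M →ₗ[ℂ] W)
    (hg : ∀ (a : H) (m : M), g (ρ a m) = δ (ι ℂ (a : L)) (g m))
    (u : UniversalEnvelopingAlgebra ℂ L) (v : Induced H ρ) :
    inducedLift δ g hg (u • v) = δ u (inducedLift δ g hg v) := by
  induction v using Submodule.Quotient.induction_on with
  | H z =>
    rw [← Submodule.Quotient.mk_smul]
    change TensorProduct.lift (LinearMap.flip (LinearMap.flip δ.toLinearMap ∘ₗ g)) (u • z) =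
      δ u (TensorProduct.lift (LinearMap.flip (LinearMap.flip δ.toLinearMap ∘ₗ g)) z)
    induction z using TensorProduct.induction_on with
    | zero => simp
    | add x y hx hy => simp only [smul_add, map_add, hx, hy]
    | tmul v m => rw [TensorProduct.smul_tmul']; simp

lemma ι_smul_inducedMk (a : H) (m : M) :
    ι ℂ (a : L) • inducedMk H ρ m = inducedMk H ρ (ρ a m) := by
  change (inducedRelations H ρ).mkQ (ι ℂ (a : L) • ((1 : UniversalEnvelopingAlgebra ℂ L) ⊗ₜ m)) =
    (inducedRelations H ρ).mkQ (1 ⊗ₜ (ρ a m))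
  rw [← sub_eq_zero, ← map_sub, ← LinearMap.mem_ker, Submodule.ker_mkQ]
  refine Submodule.subset_span ⟨1, a, m, ?_⟩
  rw [TensorProduct.smul_tmul', smul_eq_mul, one_mul, mul_one]

/-- The induced module is generated by `M`. -/
theorem induced_induction {C : Induced H ρ → Prop} (mk : ∀ m, C (inducedMk H ρ m))
    (add : ∀ v w, C v → C w → C (v + w)) (smul : ∀ (c : ℂ) v, C v → C (c • v))
    (lie : ∀ (x : L) v, C v → C (ι ℂ x • v)) (v : Induced H ρ) : C v := by
  have key (u : UniversalEnvelopingAlgebra ℂ L) (m : M) : C (u • inducedMk H ρ m) := by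
    induction u using enveloping_induction with
    | one => rw [one_smul]; exact mk m
    | add u v h h' => rw [add_smul]; exact add _ _ h h'
    | smul c u h => rw [smul_assoc]; exact smul _ _ h
    | mul x u h => rw [mul_smul]; exact lie _ _ h
  induction v using Submodule.Quotient.induction_on with
  | H z =>
    induction z using TensorProduct.induction_on with
    | zero => simpa using smul 0 _ (key 1 0)
    | add x y hx hy => exact add _ _ hx hy
    | tmul u m =>
      have := key u m
      have e : u • inducedMk H ρ m = Submodule.Quotient.mk (u ⊗ₜ m) := by
        change u • (inducedRelations H ρ).mkQ (1 ⊗ₜ m) = (inducedRelations H ρ).mkQ (u ⊗ₜ m)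
        rw [← map_smul, TensorProduct.smul_tmul', smul_eq_mul, mul_one]
      rwa [e] at this

end Lift

/-! ### The module `U(A) ⊗ M` for a triangular decomposition -/

section Triangular

variable (A : LieSubalgebra ℂ L) {M : Type*} [AddCommGroup M] [Module ℂ M]

/-- The action of `A` on the linear maps from `L` to `U(A) ⊗ M`. -/
def homAction : A →ₗ⁅ℂ⁆ Module.End ℂ (L →ₗ[ℂ] UniversalEnvelopingAlgebra ℂ A ⊗[ℂ] M) where
  toFun a :=
    { toFun := fun φ =>
        -- Here `φ` stands for `x ↦ x · w`. The formula is the one forced on `x ↦ x · (a w)` by `x a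
        -- = a x + [x, a]`.
        { toFun := fun x => ι ℂ a • φ x + φ ⁅x, (a : L)⁆
          map_add' := fun x y => by simp only [map_add, smul_add, add_lie]; abel
          map_smul' := fun c x => by
            simp only [map_smul, smul_lie, RingHom.id_apply, smul_add, smul_comm c] }
      map_add' := fun φ ψ => by
        ext x
        simp only [LinearMap.add_apply, LinearMap.coe_mk, AddHom.coe_mk, smul_add]
        abel
      map_smul' := fun c φ => by
        ext x
        simp only [LinearMap.smul_apply, LinearMap.coe_mk, AddHom.coe_mk, smul_add, smul_comm c,
          RingHom.id_apply] }
  map_add' a b := by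
    ext φ x
    have h : ((a + b : A) : L) = a + b := rfl
    simp only [LinearMap.add_apply, LinearMap.coe_mk, AddHom.coe_mk, map_add, add_smul, h, lie_add]
    abel
  map_smul' c a := by
    ext φ x
    have h : ((c • a : A) : L) = c • (a : L) := rfl
    simp only [LinearMap.smul_apply, LinearMap.coe_mk, AddHom.coe_mk, map_smul, smul_assoc, h,
      lie_smul, RingHom.id_apply, smul_add]
  map_lie' := by
    intro a b
    ext φ x
    simp only [LinearMap.coe_mk, AddHom.coe_mk, LieHom.map_lie, Ring.lie_def, LinearMap.sub_apply,
      Module.End.mul_apply, sub_smul, mul_smul, smul_add, LieSubalgebra.coe_bracket]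
    rw [leibniz_lie x (a : L) (b : L), map_add, ← lie_skew (a : L) ⁅x, (b : L)⁆, map_neg]
    abel

variable (p : L →ₗ[ℂ] A) (g : L →ₗ[ℂ] Module.End ℂ M)

/-- The action of `L` on the generators `1 ⊗ m`. -/
def triangularInit : M →ₗ[ℂ] L →ₗ[ℂ] UniversalEnvelopingAlgebra ℂ A ⊗[ℂ] M :=
  LinearMap.mk₂ ℂ (fun m x => ι ℂ (p x) ⊗ₜ m + 1 ⊗ₜ g x m)
    (fun m m' x => by simp only [TensorProduct.tmul_add, map_add]; abel)
    (fun c m x => by simp only [TensorProduct.tmul_smul, map_smul, smul_add])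
    (fun m x y => by
      simp only [TensorProduct.tmul_add, TensorProduct.add_tmul, map_add, LinearMap.add_apply]; abel)
    (fun c m x => by
      simp only [TensorProduct.tmul_smul, TensorProduct.smul_tmul', map_smul, smul_add,
        LinearMap.smul_apply])

/-- The operators by which `L` acts on `U(A) ⊗ M`. -/
def triangularMap : L →ₗ[ℂ] Module.End ℂ (UniversalEnvelopingAlgebra ℂ A ⊗[ℂ] M) :=
  (TensorProduct.lift (LinearMap.flip (LinearMap.flip
    (UniversalEnvelopingAlgebra.lift ℂ (homAction A (M := M))).toLinearMap ∘ₗ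
      triangularInit A p g))).flip

lemma triangularMap_one_tmul (x : L) (m : M) :
    triangularMap A p g x (1 ⊗ₜ m) = ι ℂ (p x) ⊗ₜ m + 1 ⊗ₜ g x m := by
  simp [triangularMap, triangularInit]

/-- The recursion `x a = a x + [x, a]` built into `homAction`. Together with the values on `1 ⊗ m`
it determines the operators. -/
lemma triangularMap_smul (x : L) (a : A) (w : UniversalEnvelopingAlgebra ℂ A ⊗[ℂ] M) :
    triangularMap A p g x (ι ℂ a • w) =
      ι ℂ a • triangularMap A p g x w + triangularMap A p g ⁅x, (a : L)⁆ w := by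
  induction w using TensorProduct.induction_on with
  | zero => simp
  | add w w' h h' => simp only [smul_add, map_add, h, h']; abel
  | tmul u m =>
    rw [TensorProduct.smul_tmul']
    simp only [triangularMap, LinearMap.flip_apply, TensorProduct.lift.tmul, smul_eq_mul,
      AlgHom.toLinearMap_apply, map_mul, LinearMap.comp_apply, Module.End.mul_apply,
      UniversalEnvelopingAlgebra.lift_ι_apply]
    rfl

/-- `U(A) ⊗ M` is spanned by the words in `A` applied to `1 ⊗ M`. -/
theorem tensor_induction {C : UniversalEnvelopingAlgebra ℂ A ⊗[ℂ] M → Prop}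
    (one : ∀ m, C (1 ⊗ₜ m)) (add : ∀ v w, C v → C w → C (v + w))
    (smul : ∀ (c : ℂ) v, C v → C (c • v)) (lie : ∀ (a : A) v, C v → C (ι ℂ a • v))
    (w : UniversalEnvelopingAlgebra ℂ A ⊗[ℂ] M) : C w := by
  induction w using TensorProduct.induction_on with
  | zero => simpa using smul 0 _ (one 0)
  | add w w' h h' => exact add _ _ h h'
  | tmul u m =>
    induction u using enveloping_induction with
    | one => exact one m
    | add u v h h' => rw [TensorProduct.add_tmul]; exact add _ _ h h'
    | smul c u h => rw [← TensorProduct.smul_tmul']; exact smul _ _ h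
    | mul x u h =>
      have := lie x _ h
      rwa [TensorProduct.smul_tmul'] at this

variable {A p g} (hp : ∀ a : A, p (a : L) = a) (hg : ∀ a : A, g (a : L) = 0)

include hp hg in
-- Induction on words: the recursion for moving `a` past `b` is exactly the relation `a b = b a +
-- [a, b]` in `U(A)`.
lemma triangularMap_coe (a : A) (w : UniversalEnvelopingAlgebra ℂ A ⊗[ℂ] M) :
    triangularMap A p g (a : L) w = ι ℂ a • w := by
  induction w using tensor_induction generalizing a with
  | one m =>
    rw [triangularMap_one_tmul, hp, hg, TensorProduct.smul_tmul', smul_eq_mul, mul_one]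
    simp
  | add v w hv hw => rw [map_add, hv, hw, smul_add]
  | smul c v hv => rw [map_smul, hv, smul_comm]
  | lie b v hv =>
    rw [triangularMap_smul, hv, ← LieSubalgebra.coe_bracket, hv, LieHom.map_lie, Ring.lie_def,
      sub_smul, mul_smul, mul_smul]
    abel

include hp hg in
/-- The operators `triangularMap` represent `L`. -/
lemma triangularMap_lie (H : LieSubalgebra ℂ L) (hH : ∀ x ∈ H, p x = 0)
    (hpH : ∀ x, x - (p x : L) ∈ H)
    (hgH : ∀ x ∈ H, ∀ y ∈ H, g ⁅x, y⁆ = ⁅g x, g y⁆) (x y : L) :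
    triangularMap A p g ⁅x, y⁆ = ⁅triangularMap A p g x, triangularMap A p g y⁆ := by
  set D := triangularMap A p g with hD
  -- On generators, `x` and `y` are split into their `A`- and `H`-parts. If one argument is in `A`
  -- the relation is the recursion; if both are in `H` it is the hypothesis on `g`.
  have hbase (m : M) (x y : L) : D ⁅x, y⁆ (1 ⊗ₜ m) = D x (D y (1 ⊗ₜ m)) - D y (D x (1 ⊗ₜ m)) := by
    have hA (x : L) (a : A) : D ⁅x, (a : L)⁆ (1 ⊗ₜ m) =
        D x (D (a : L) (1 ⊗ₜ m)) - D (a : L) (D x (1 ⊗ₜ m)) := by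
      rw [hD, triangularMap_coe hp hg, triangularMap_coe hp hg, triangularMap_smul]
      abel
    have hB (x : L) (hx : x ∈ H) (m : M) : D x (1 ⊗ₜ m) = 1 ⊗ₜ g x m := by
      rw [hD, triangularMap_one_tmul, hH x hx, map_zero, TensorProduct.zero_tmul, zero_add]
    have hy : y = (y - (p y : L)) + (p y : L) := (sub_add_cancel _ _).symm
    have hx : x = (x - (p x : L)) + (p x : L) := (sub_add_cancel _ _).symm
    set a := p x
    set b := p y
    set x' := x - (a : L) with hx'
    set y' := y - (b : L) with hy'
    have hx'H : x' ∈ H := hpH x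
    have hy'H : y' ∈ H := hpH y
    have h1 : D ⁅x, (b : L)⁆ (1 ⊗ₜ m) = _ := hA x b
    have h2 : D ⁅x', y'⁆ (1 ⊗ₜ m) = D x' (D y' (1 ⊗ₜ m)) - D y' (D x' (1 ⊗ₜ m)) := by
      rw [hB _ (H.lie_mem hx'H hy'H), hB _ hx'H, hB _ hy'H, hB _ hx'H, hB _ hy'H, hgH _ hx'H _ hy'H,
        ← TensorProduct.tmul_sub, Ring.lie_def]
      rfl
    have h3 : D ⁅(a : L), y'⁆ (1 ⊗ₜ m) = D a (D y' (1 ⊗ₜ m)) - D y' (D a (1 ⊗ₜ m)) := by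
      rw [← lie_skew, map_neg, LinearMap.neg_apply, hA]; abel
    have e1 : D ⁅x, y⁆ (1 ⊗ₜ m) =
        D ⁅x', y'⁆ (1 ⊗ₜ m) + D ⁅(a : L), y'⁆ (1 ⊗ₜ m) + D ⁅x, (b : L)⁆ (1 ⊗ₜ m) := by
      conv_lhs => rw [hy, lie_add, map_add]
      nth_rewrite 1 [hx]
      rw [add_lie, map_add]
      rfl
    rw [e1, h1, h2, h3]
    have e2 : D y = D y' + D b := by rw [← map_add, ← hy]
    have e3 : D x = D x' + D a := by rw [← map_add, ← hx]
    rw [e2, e3]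
    simp only [LinearMap.add_apply, map_add]
    abel
  refine LinearMap.ext fun w => ?_
  rw [Ring.lie_def]
  change D ⁅x, y⁆ w = D x (D y w) - D y (D x w)
  induction w using tensor_induction generalizing x y with
  | one m => exact hbase m x y
  | add v w hv hw => simp only [map_add, hv, hw]; abel
  | smul c v hv => simp only [map_smul, hv, smul_sub]
  | lie a v hv =>
    have hs (x : L) (w) : D x (ι ℂ a • w) = ι ℂ a • D x w + D ⁅x, (a : L)⁆ w :=
      triangularMap_smul A p g x a w
    -- Jacobi carries the relation from `v` to `a v`; it needs the relation at `v` for the brackets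
    -- with `a` too, hence the generalisation over `x` and `y`.
    have hj : ⁅⁅x, y⁆, (a : L)⁆ = ⁅⁅x, (a : L)⁆, y⁆ + ⁅x, ⁅y, (a : L)⁆⁆ := by
      rw [lie_lie, leibniz_lie x y, ← lie_skew ⁅x, (a : L)⁆ y]; abel
    simp only [hs, map_add]
    rw [hj, map_add, LinearMap.add_apply, hv ⁅x, (a : L)⁆ y, hv x ⁅y, (a : L)⁆, hv x y, smul_sub]
    abel

end Triangular

end Enveloping

/-! ### The triangular decomposition of the affine algebra -/

section AffineTriangular

open AffineSl2
open UniversalEnvelopingAlgebra (ι)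

lemma loopMode_add (x y : Sl2) (n : ℤ) : loopMode (x + y) n = loopMode x n + loopMode y n := by
  apply loopCoeff.injective
  simp [loopCoeff_loopMode]

lemma loopMode_smul (c : ℂ) (x : Sl2) (n : ℤ) : loopMode (c • x) n = c • loopMode x n := by
  apply loopCoeff.injective
  simp [loopCoeff_loopMode]

/-- The linear map `x ↦ xₙ`. -/
def modeMap (n : ℤ) : Sl2 →ₗ[ℂ] AffineSl2 where
  toFun x := mode x n
  map_add' x y := by ext <;> simp [mode, loopMode_add]
  map_smul' c x := by ext <;> simp [mode, loopMode_smul]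

lemma modeMap_apply (n : ℤ) (x : Sl2) : modeMap n x = mode x n := rfl

theorem affine_induction {C : AffineSl2 → Prop} (add : ∀ X Y, C X → C Y → C (X + Y))
    (smul : ∀ (c : ℂ) X, C X → C (c • X)) (hK : C K) (hL0 : C L0) (hmode : ∀ x n, C (mode x n))
    (X : AffineSl2) : C X := by
  have hloop (f : Loop) : C (mk f 0 0) := by
    induction f using loop_induction with
    | h0 =>
      have h := smul 0 _ hK
      rwa [zero_smul] at h
    | hadd f g hf hg =>
      have : mk (f + g) 0 0 = mk f 0 0 + mk g 0 0 := by ext <;> simp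
      rw [this]; exact add _ _ hf hg
    | hmode x n => exact hmode x n
  have : X = mk (loop X) 0 0 + (coeffK X • K + coeffL0 X • L0) := by
    ext <;> simp [K, L0]
  rw [this]
  exact add _ _ (hloop _) (add _ _ (smul _ _ hK) (smul _ _ hL0))

/-- The subalgebra spanned by the modes `xₙ` with `n < 0`. -/
def negative : LieSubalgebra ℂ AffineSl2 :=
  { Submodule.span ℂ {X | ∃ (x : Sl2) (n : ℤ), n < 0 ∧ X = mode x n} with
    lie_mem' := by
      intro X Y hX hY
      set S : Set AffineSl2 := {X | ∃ (x : Sl2) (n : ℤ), n < 0 ∧ X = mode x n}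
      change X ∈ Submodule.span ℂ S at hX
      change Y ∈ Submodule.span ℂ S at hY
      change ⁅X, Y⁆ ∈ Submodule.span ℂ S
      induction hX using Submodule.span_induction with
      | zero => rw [zero_lie]; exact Submodule.zero_mem _
      | add X X' _ _ h h' => rw [add_lie]; exact Submodule.add_mem _ h h'
      | smul c X _ h => rw [smul_lie]; exact Submodule.smul_mem _ c h
      | mem X hX =>
        induction hY using Submodule.span_induction with
        | zero => rw [lie_zero]; exact Submodule.zero_mem _
        | add Y Y' _ _ h h' => rw [lie_add]; exact Submodule.add_mem _ h h'
        | smul c Y _ h => rw [lie_smul]; exact Submodule.smul_mem _ c h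
        | mem Y hY =>
          obtain ⟨x, m, hm, rfl⟩ := hX
          obtain ⟨y, n, hn, rfl⟩ := hY
          rw [mode_lie_mode, if_neg (by omega), zero_smul, add_zero]
          exact Submodule.subset_span ⟨_, m + n, by omega, rfl⟩ }

lemma mode_mem_negative (x : Sl2) {n : ℤ} (hn : n < 0) : mode x n ∈ negative :=
  Submodule.subset_span (s := {X | ∃ (x : Sl2) (n : ℤ), n < 0 ∧ X = mode x n}) ⟨x, n, hn, rfl⟩

lemma K_mem_nonneg : K ∈ nonneg := Submodule.subset_span (s := nonnegGens) (Or.inl rfl)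

lemma L0_mem_nonneg : L0 ∈ nonneg := Submodule.subset_span (s := nonnegGens) (Or.inr (Or.inl rfl))

lemma mode_mem_nonneg (x : Sl2) {n : ℤ} (hn : 0 ≤ n) : mode x n ∈ nonneg := by
  obtain ⟨n, rfl⟩ := Int.eq_ofNat_of_zero_le hn
  exact Submodule.subset_span (s := nonnegGens) (Or.inr (Or.inr ⟨x, n, rfl⟩))

lemma negative_induction {C : ∀ X, X ∈ negative → Prop} (zero : C 0 negative.zero_mem)
    (add : ∀ X Y hX hY, C X hX → C Y hY → C (X + Y) (negative.add_mem hX hY))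
    (smul : ∀ (c : ℂ) X hX, C X hX → C (c • X) (negative.smul_mem c hX))
    (hmode : ∀ x n (hn : n < 0), C (mode x n) (mode_mem_negative x hn))
    {X : AffineSl2} (hX : X ∈ negative) : C X hX := by
  change X ∈ Submodule.span ℂ {X | ∃ (x : Sl2) (n : ℤ), n < 0 ∧ X = mode x n} at hX
  induction hX using Submodule.span_induction with
  | zero => exact zero
  | add X Y _ _ h h' => exact add _ _ _ _ h h'
  | smul c X _ h => exact smul _ _ _ h
  | mem X hX => obtain ⟨x, n, hn, rfl⟩ := hX; exact hmode x n hn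

lemma nonneg_induction {C : ∀ X, X ∈ nonneg → Prop} (zero : C 0 nonneg.zero_mem)
    (add : ∀ X Y hX hY, C X hX → C Y hY → C (X + Y) (nonneg.add_mem hX hY))
    (smul : ∀ (c : ℂ) X hX, C X hX → C (c • X) (nonneg.smul_mem c hX))
    (hK : C K K_mem_nonneg) (hL0 : C L0 L0_mem_nonneg)
    (hmode : ∀ (x : Sl2) (n : ℤ) (hn : 0 ≤ n), C (mode x n) (mode_mem_nonneg x hn))
    {X : AffineSl2} (hX : X ∈ nonneg) : C X hX := by
  change X ∈ Submodule.span ℂ nonnegGens at hX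
  induction hX using Submodule.span_induction with
  | zero => exact zero
  | add X Y _ _ h h' => exact add _ _ _ _ h h'
  | smul c X _ h => exact smul _ _ _ h
  | mem X hX =>
    obtain rfl | rfl | ⟨x, n, rfl⟩ := hX
    · exact hK
    · exact hL0
    · exact hmode x n (by omega)

/-- The projection of the affine algebra to its negative part. -/
def negProj : AffineSl2 →ₗ[ℂ] negative :=
  (Finsupp.lsum ℂ fun n : ℤ => if h : n < 0 then
    (modeMap n).codRestrict negative.toSubmodule (fun x => mode_mem_negative x h) else 0) ∘ₗ
    loopCoeff.toLinearMap ∘ₗ loop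

lemma negProj_mode_of_neg (x : Sl2) {n : ℤ} (hn : n < 0) :
    negProj (mode x n) = ⟨mode x n, mode_mem_negative x hn⟩ := by
  simp only [negProj, LinearMap.comp_apply, mode, loop_mk, LinearEquiv.coe_coe, loopCoeff_loopMode,
    Finsupp.lsum_apply]
  rw [Finsupp.sum_single_index (by simp), dif_pos hn]
  rfl

lemma negProj_mode_of_nonneg (x : Sl2) {n : ℤ} (hn : 0 ≤ n) : negProj (mode x n) = 0 := by
  simp only [negProj, LinearMap.comp_apply, mode, loop_mk, LinearEquiv.coe_coe, loopCoeff_loopMode,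
    Finsupp.lsum_apply]
  rw [Finsupp.sum_single_index (by simp), dif_neg (by omega)]
  rfl

lemma negProj_K : negProj K = 0 := by simp [negProj, K]

lemma negProj_L0 : negProj L0 = 0 := by simp [negProj, L0]

lemma negProj_coe (a : negative) : negProj (a : AffineSl2) = a := by
  suffices h : ∀ X ∈ negative, (negProj X : AffineSl2) = X from Subtype.ext (h a a.2)
  intro X hX
  induction hX using negative_induction with
  | zero => simp
  | add X Y _ _ h h' => rw [map_add]; exact congrArg₂ (· + ·) h h'
  | smul c X _ h => rw [map_smul]; exact congrArg (c • ·) h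
  | hmode x n hn => rw [negProj_mode_of_neg x hn]

lemma negProj_of_mem_nonneg {X : AffineSl2} (hX : X ∈ nonneg) : negProj X = 0 := by
  induction hX using nonneg_induction with
  | zero => simp
  | add X Y _ _ h h' => rw [map_add, h, h', add_zero]
  | smul c X _ h => rw [map_smul, h, smul_zero]
  | hK => exact negProj_K
  | hL0 => exact negProj_L0
  | hmode x n hn => exact negProj_mode_of_nonneg x hn

lemma sub_negProj_mem (X : AffineSl2) : X - (negProj X : AffineSl2) ∈ nonneg := by
  induction X using affine_induction with
  | add X Y h h' =>
    have := add_mem h h'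
    rw [map_add]
    convert this using 1
    change X + Y - ((negProj X : AffineSl2) + (negProj Y : AffineSl2)) = _
    abel
  | smul c X h =>
    have := nonneg.smul_mem c h
    rw [smul_sub] at this
    rw [map_smul]
    exact this
  | hK => rw [negProj_K]; simpa using K_mem_nonneg
  | hL0 => rw [negProj_L0]; simpa using L0_mem_nonneg
  | hmode x n =>
    by_cases hn : n < 0
    · rw [negProj_mode_of_neg x hn, sub_self]; exact zero_mem _
    · rw [negProj_mode_of_nonneg x (by omega)]
      simpa using mode_mem_nonneg x (by omega)

variable {M : Type*} [AddCommGroup M] [Module ℂ M] (k Δ : ℂ) (π : Sl2 →ₗ⁅ℂ⁆ Module.End ℂ M)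

lemma groundMap_negative (a : negative) : groundMap k Δ π (a : AffineSl2) = 0 := by
  suffices h : ∀ X ∈ negative, groundMap k Δ π X = 0 from h a a.2
  intro X hX
  induction hX using negative_induction with
  | zero => simp
  | add X Y _ _ h h' => rw [map_add, h, h', add_zero]
  | smul c X _ h => rw [map_smul, h, smul_zero]
  | hmode x n hn => rw [groundMap_mode, if_neg (by omega)]

/-- The affine algebra acts on `U(negative) ⊗ M`. -/
def triangularRep :
    AffineSl2 →ₗ⁅ℂ⁆ Module.End ℂ (UniversalEnvelopingAlgebra ℂ negative ⊗[ℂ] M) :=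
  { triangularMap negative negProj (groundMap k Δ π) with
    map_lie' := fun {X Y} => triangularMap_lie negProj_coe (groundMap_negative k Δ π)
      nonneg (fun _ h => negProj_of_mem_nonneg h) sub_negProj_mem
      (fun X hX Y hY => groundMap_lie k Δ π X Y hX hY) X Y }

lemma triangularRep_apply (X : AffineSl2) (w : UniversalEnvelopingAlgebra ℂ negative ⊗[ℂ] M) :
    triangularRep k Δ π X w = triangularMap negative negProj (groundMap k Δ π) X w := rfl

/-- The map `ε ⊗ 1`, where `ε` is the counit of `U(negative)`. -/
def counitTensor : UniversalEnvelopingAlgebra ℂ negative ⊗[ℂ] M →ₗ[ℂ] M :=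
  TensorProduct.lift (LinearMap.lsmul ℂ M ∘ₗ
    (UniversalEnvelopingAlgebra.lift ℂ (0 : negative →ₗ⁅ℂ⁆ ℂ)).toLinearMap)

lemma counitTensor_one (m : M) : counitTensor (1 ⊗ₜ m) = m := by
  simp [counitTensor]

lemma counitTensor_smul (a : negative) (w : UniversalEnvelopingAlgebra ℂ negative ⊗[ℂ] M) :
    counitTensor (ι ℂ a • w) = 0 := by
  induction w using TensorProduct.induction_on with
  | zero => simp
  | add v w hv hw => rw [smul_add, map_add, hv, hw, add_zero]
  | tmul u m =>
    rw [TensorProduct.smul_tmul']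
    simp only [counitTensor, TensorProduct.lift.tmul, smul_eq_mul, LinearMap.comp_apply,
      AlgHom.toLinearMap_apply, map_mul, UniversalEnvelopingAlgebra.lift_ι_apply]
    simp

/-- Zero modes normalise the negative part. Moving `x₀` past a negative factor leaves only terms
with a negative factor in front, and the counit kills these. -/
lemma counitTensor_mode_zero (x : Sl2) (w : UniversalEnvelopingAlgebra ℂ negative ⊗[ℂ] M) :
    counitTensor (triangularRep k Δ π (mode x 0) w) = π x (counitTensor w) := by
  induction w using tensor_induction with
  | one m =>
    rw [triangularRep_apply, triangularMap_one_tmul, negProj_mode_of_nonneg x le_rfl, map_zero,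
      TensorProduct.zero_tmul, zero_add, counitTensor_one, counitTensor_one, groundMap_mode,
      if_pos rfl]
  | add v w hv hw => simp only [map_add, hv, hw]
  | smul c v hv => simp only [map_smul, hv]
  | lie a v _ =>
    have h : ⁅mode x 0, (a : AffineSl2)⁆ ∈ negative := by
      obtain ⟨a, ha⟩ := a
      induction ha using negative_induction with
      | zero => simp
      | add X Y _ _ h h' => simpa only [lie_add] using add_mem h h'
      | smul c X _ h =>
        simp only [lie_smul]
        exact negative.smul_mem c h
      | hmode y n hn =>
        change ⁅mode x 0, mode y n⁆ ∈ negative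
        rw [mode_lie_mode, if_neg (by omega), zero_smul, add_zero, zero_add]
        exact mode_mem_negative _ hn
    rw [triangularRep_apply, triangularMap_smul, map_add, counitTensor_smul, zero_add,
      counitTensor_smul, map_zero]
    exact (congrArg counitTensor
      (triangularMap_coe negProj_coe (groundMap_negative k Δ π) ⟨_, h⟩ v)).trans
      (counitTensor_smul _ _)

/-! ### The projection of a relaxed Verma module to its ground states -/

/-- The projection of a relaxed Verma module to its ground states. -/
def groundProj : RelaxedVerma k Δ π →ₗ[ℂ] M :=
  counitTensor ∘ₗ inducedLift (UniversalEnvelopingAlgebra.lift ℂ (triangularRep k Δ π))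
    (TensorProduct.mk ℂ (UniversalEnvelopingAlgebra ℂ negative) M 1) (by
      intro a m
      rw [UniversalEnvelopingAlgebra.lift_ι_apply, TensorProduct.mk_apply, TensorProduct.mk_apply,
        triangularRep_apply, triangularMap_one_tmul, negProj_of_mem_nonneg a.2, map_zero,
        TensorProduct.zero_tmul, zero_add]
      rfl)

/-- In particular `M` embeds in the relaxed Verma module, which is not evident from its presentation
by relations. -/
lemma groundProj_mk (m : M) : groundProj k Δ π (inducedMk nonneg (groundRep k Δ π) m) = m := by
  rw [groundProj, LinearMap.comp_apply, inducedLift_mk, TensorProduct.mk_apply, counitTensor_one]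

lemma groundProj_mode_neg (x : Sl2) {n : ℤ} (hn : n < 0) (v : RelaxedVerma k Δ π) :
    groundProj k Δ π (ι ℂ (mode x n) • v) = 0 := by
  rw [groundProj, LinearMap.comp_apply, inducedLift_smul, UniversalEnvelopingAlgebra.lift_ι_apply,
    triangularRep_apply]
  exact (congrArg counitTensor (triangularMap_coe negProj_coe (groundMap_negative k Δ π)
      ⟨_, mode_mem_negative x hn⟩ _)).trans (counitTensor_smul _ _)

lemma groundProj_mode_zero (x : Sl2) (v : RelaxedVerma k Δ π) :
    groundProj k Δ π (ι ℂ (mode x 0) • v) = π x (groundProj k Δ π v) := by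
  simp only [groundProj, LinearMap.comp_apply, inducedLift_smul,
    UniversalEnvelopingAlgebra.lift_ι_apply, counitTensor_mode_zero]

end AffineTriangular

/-! ### Spanning sets of relaxed Verma modules -/

section Words

open AffineSl2
open UniversalEnvelopingAlgebra (ι)

/-- The basis `e`, `h`, `f` of `sl₂`. -/
def sl2Basis : Fin 3 → Sl2 := ![sl2e, sl2h, sl2f]

/-- The weights of the basis of `sl₂`, as multiples of `α`. -/
def sl2Root : Fin 3 → ℤ := ![1, 0, -1]

lemma sl2_eq_sum (x : Sl2) : x = x.1 0 1 • sl2e + x.1 0 0 • sl2h + x.1 1 0 • sl2f := by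
  apply Subtype.ext
  change x.1 = x.1 0 1 • sl2e.1 + x.1 0 0 • sl2h.1 + x.1 1 0 • sl2f.1
  ext i j
  fin_cases i <;> fin_cases j <;> simp [sl2e, sl2h, sl2f, sl2_trace]

lemma sl2h_lie_basis (i : Fin 3) : ⁅sl2h, sl2Basis i⁆ = (2 * (sl2Root i : ℂ)) • sl2Basis i := by
  obtain ⟨h1, -, h3⟩ := sl2_relations
  fin_cases i
  · simpa [sl2Basis, sl2Root] using h1
  · simp [sl2Basis, sl2Root]
  · simpa [sl2Basis, sl2Root] using h3

/-- The product of modes `xₙ` with `n < 0` encoded by a list; `(i, n)` stands for the mode of index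
`-(n+1)` of the `i`-th basis element. -/
def wordElt : List (Fin 3 × ℕ) → UAffine
  | [] => 1
  | a :: l => ι ℂ (mode (sl2Basis a.1) (-(a.2 + 1 : ℤ))) * wordElt l

/-- The degree of a word. -/
def wordDeg : List (Fin 3 × ℕ) → ℕ
  | [] => 0
  | a :: l => (a.2 + 1) + wordDeg l

/-- The weight of a word, as a multiple of `α`. -/
def wordRoot : List (Fin 3 × ℕ) → ℤ
  | [] => 0
  | a :: l => sl2Root a.1 + wordRoot l

/-- Each letter has degree at least one, which bounds the head and the degree of the tail. Words are
unordered: they only need to span, so the redundancy is harmless. -/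
lemma finite_wordDeg_eq (N : ℕ) : {l | wordDeg l = N}.Finite := by
  induction N using Nat.strong_induction_on with
  | _ N ih =>
    have hfin : ((Set.univ ×ˢ Set.Iio N : Set (Fin 3 × ℕ))).Finite :=
      Set.finite_univ.prod (Set.finite_Iio N)
    have hfin' : (⋃ n ∈ Set.Iio N, {l | wordDeg l = n}).Finite :=
      (Set.finite_Iio N).biUnion fun n hn => ih n hn
    refine ((Set.finite_singleton []).union (hfin.image2 List.cons hfin')).subset ?_
    intro l hl
    cases l with
    | nil => left; rfl
    | cons a l =>
      right
      simp only [Set.mem_ofPred_eq, wordDeg] at hl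
      refine ⟨a, ⟨trivial, ?_⟩, l, ?_, rfl⟩
      · simp only [Set.mem_Iio]; omega
      · simp only [Set.mem_Iio, Set.mem_iUnion, Set.mem_ofPred_eq, exists_prop]
        exact ⟨_, by omega, rfl⟩

lemma ι_smul_comm {V : Type*} [AddCommGroup V] [Module UAffine V] (X Y : AffineSl2) (v : V) :
    ι ℂ X • ι ℂ Y • v = ι ℂ Y • ι ℂ X • v + ι ℂ ⁅X, Y⁆ • v := by
  rw [LieHom.map_lie, Ring.lie_def, sub_smul, mul_smul, mul_smul]
  abel

variable {M : Type*} [AddCommGroup M] [Module ℂ M] (k Δ : ℂ) (π : Sl2 →ₗ⁅ℂ⁆ Module.End ℂ M)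

/-- The embedding of the space of ground states. -/
abbrev groundMk : M →ₗ[ℂ] RelaxedVerma k Δ π := inducedMk nonneg (groundRep k Δ π)

/-! ### Action of the affine algebra on ground states and words -/

lemma K_smul_groundMk (m : M) : ι ℂ K • groundMk k Δ π m = k • groundMk k Δ π m := by
  have h := ι_smul_inducedMk (ρ := groundRep k Δ π) ⟨K, K_mem_nonneg⟩ m
  rw [← LinearMap.map_smul]
  refine h.trans (congrArg _ ?_)
  change groundMap k Δ π K m = _
  rw [groundMap_K]; rfl

lemma L0_smul_groundMk (m : M) : ι ℂ L0 • groundMk k Δ π m = Δ • groundMk k Δ π m := by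
  have h := ι_smul_inducedMk (ρ := groundRep k Δ π) ⟨L0, L0_mem_nonneg⟩ m
  rw [← LinearMap.map_smul]
  refine h.trans (congrArg _ ?_)
  change groundMap k Δ π L0 m = _
  rw [groundMap_L0]; rfl

lemma mode_zero_smul_groundMk (x : Sl2) (m : M) :
    ι ℂ (mode x 0) • groundMk k Δ π m = groundMk k Δ π (π x m) := by
  have h := ι_smul_inducedMk (ρ := groundRep k Δ π) ⟨mode x 0, mode_mem_nonneg x le_rfl⟩ m
  refine h.trans (congrArg _ ?_)
  change groundMap k Δ π (mode x 0) m = _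
  rw [groundMap_mode, if_pos rfl]

lemma mode_pos_smul_groundMk (x : Sl2) {n : ℤ} (hn : 0 < n) (m : M) :
    ι ℂ (mode x n) • groundMk k Δ π m = 0 := by
  have h := ι_smul_inducedMk (ρ := groundRep k Δ π) ⟨mode x n, mode_mem_nonneg x hn.le⟩ m
  refine h.trans ?_
  have : (groundRep k Δ π ⟨mode x n, mode_mem_nonneg x hn.le⟩) m = 0 := by
    change groundMap k Δ π (mode x n) m = _
    rw [groundMap_mode, if_neg hn.ne']; rfl
  rw [this, map_zero]

lemma K_smul (v : RelaxedVerma k Δ π) : ι ℂ K • v = k • v := by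
  induction v using induced_induction with
  | mk m => exact K_smul_groundMk k Δ π m
  | add v w hv hw => rw [smul_add, hv, hw, smul_add]
  | smul c v hv => rw [smul_comm, hv, smul_comm]
  | lie X v hv => rw [ι_smul_comm, hv, K_lie, map_zero, zero_smul, add_zero, smul_comm]

lemma L0_smul_word (l : List (Fin 3 × ℕ)) (m : M) :
    ι ℂ L0 • wordElt l • groundMk k Δ π m = (Δ + wordDeg l) • wordElt l • groundMk k Δ π m := by
  induction l with
  | nil => simpa [wordElt, wordDeg] using L0_smul_groundMk k Δ π m
  | cons a l ih =>
    rw [wordElt, mul_smul, ι_smul_comm, ih, L0_lie_mode, map_smul, smul_assoc, smul_comm,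
      ← add_smul]
    congr 1
    simp only [wordDeg]
    push_cast
    ring

lemma h0_smul_word (l : List (Fin 3 × ℕ)) {m : M} {c : ℂ} (hm : π sl2h m = c • m) :
    ι ℂ (mode sl2h 0) • wordElt l • groundMk k Δ π m =
      (c + 2 * wordRoot l) • wordElt l • groundMk k Δ π m := by
  induction l with
  | nil =>
    simp only [wordElt, wordRoot, one_smul, mode_zero_smul_groundMk, hm, map_smul]
    simp
  | cons a l ih =>
    rw [wordElt, mul_smul, ι_smul_comm, ih, mode_lie_mode]
    have : (if (0 : ℤ) + -(a.2 + 1 : ℤ) = 0 then ((0 : ℤ) : ℂ) * killing sl2h (sl2Basis a.1) else 0)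
        = 0 := by simp
    rw [this, zero_smul, add_zero, zero_add, sl2h_lie_basis,
      ← modeMap_apply _ ((2 * (sl2Root a.1 : ℂ)) • _), map_smul,
      modeMap_apply, map_smul, smul_assoc, smul_comm, ← add_smul]
    congr 1
    simp only [wordRoot]
    push_cast
    ring

/-- A relaxed Verma module is spanned by the products of modes `xₙ`, `n < 0`, applied to the ground
states. -/
lemma span_words :
    Submodule.span ℂ {v | ∃ l m, v = wordElt l • groundMk k Δ π m} = ⊤ := by
  set T := Submodule.span ℂ {v | ∃ l m, v = wordElt l • groundMk k Δ π m} with hT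
  have hmem (l m) : wordElt l • groundMk k Δ π m ∈ T := Submodule.subset_span ⟨l, m, rfl⟩
  have hneg (x : Sl2) (n : ℤ) (hn : n < 0) (v) (hv : v ∈ T) : ι ℂ (mode x n) • v ∈ T := by
    induction hv using Submodule.span_induction with
    | zero => rw [smul_zero]; exact zero_mem _
    | add v w _ _ hv hw => rw [smul_add]; exact add_mem hv hw
    | smul c v _ hv => rw [smul_comm]; exact T.smul_mem c hv
    | mem v hv =>
      obtain ⟨l, m, rfl⟩ := hv
      obtain ⟨j, rfl⟩ : ∃ j : ℕ, n = -(j + 1 : ℤ) := ⟨(-n - 1).toNat, by omega⟩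
      have hb (i : Fin 3) : ι ℂ (mode (sl2Basis i) (-(j + 1 : ℤ))) •
          wordElt l • groundMk k Δ π m ∈ T := by
        rw [← mul_smul]
        exact hmem ((i, j) :: l) m
      rw [← modeMap_apply, sl2_eq_sum x]
      simp only [map_add, map_smul, add_smul, smul_assoc, modeMap_apply]
      exact add_mem (add_mem (T.smul_mem _ (hb 0)) (T.smul_mem _ (hb 1))) (T.smul_mem _ (hb 2))
  -- Induction on the length for all modes at once: commuting `xₙ` past the first letter creates a
  -- mode of another index acting on the shorter word.
  have hpos (l m) : ∀ (x : Sl2) (n : ℤ), ι ℂ (mode x n) • wordElt l • groundMk k Δ π m ∈ T := by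
    induction l with
    | nil =>
      intro x n
      rcases lt_trichotomy n 0 with hn | rfl | hn
      · exact hneg x n hn _ (hmem _ _)
      · rw [wordElt, one_smul, mode_zero_smul_groundMk]
        simpa [wordElt] using hmem [] (π x m)
      · rw [wordElt, one_smul, mode_pos_smul_groundMk _ _ _ _ hn]; exact zero_mem _
    | cons a l ih =>
      intro x n
      rw [wordElt, mul_smul, ι_smul_comm, mode_lie_mode, map_add, add_smul, map_smul, smul_assoc,
        K_smul]
      exact add_mem (hneg _ _ (by omega) _ (ih _ _))
        (add_mem (ih _ _) (T.smul_mem _ (T.smul_mem _ (hmem _ _))))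
  rw [eq_top_iff]
  rintro v -
  induction v using induced_induction with
  | mk m => simpa [wordElt] using hmem [] m
  | add v w hv hw => exact add_mem hv hw
  | smul c v hv => exact T.smul_mem c hv
  | lie X v hv =>
    induction hv using Submodule.span_induction with
    | zero => rw [smul_zero]; exact zero_mem _
    | add v w _ _ hv hw => rw [smul_add]; exact add_mem hv hw
    | smul c v _ hv => rw [smul_comm]; exact T.smul_mem c hv
    | mem v hv =>
      obtain ⟨l, m, rfl⟩ := hv
      induction X using affine_induction with
      | add X Y h h' => rw [map_add, add_smul]; exact add_mem h h'
      | smul c X h => rw [map_smul, smul_assoc]; exact T.smul_mem c h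
      | hK => rw [K_smul]; exact T.smul_mem _ (hmem _ _)
      | hL0 => rw [L0_smul_word]; exact T.smul_mem _ (hmem _ _)
      | hmode x n => exact hpos l m x n

theorem word_induction {C : RelaxedVerma k Δ π → Prop}
    (word : ∀ l m, C (wordElt l • groundMk k Δ π m)) (add : ∀ v w, C v → C w → C (v + w))
    (smul : ∀ (c : ℂ) v, C v → C (c • v)) (v : RelaxedVerma k Δ π) : C v := by
  have hv : v ∈ Submodule.span ℂ {v | ∃ l m, v = wordElt l • groundMk k Δ π m} := by
    rw [span_words]; trivial
  induction hv using Submodule.span_induction with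
  | zero => simpa using smul 0 _ (word [] 0)
  | add v w _ _ hv hw => exact add _ _ hv hw
  | smul c v _ hv => exact smul _ _ hv
  | mem v hv => obtain ⟨l, m, rfl⟩ := hv; exact word l m

lemma groundProj_word_cons (a : Fin 3 × ℕ) (l : List (Fin 3 × ℕ)) (v : RelaxedVerma k Δ π) :
    groundProj k Δ π (wordElt (a :: l) • v) = 0 := by
  rw [wordElt, mul_smul, groundProj_mode_neg _ _ _ _ (by omega)]

/-! ### Functoriality -/

section Functoriality

variable {M' : Type*} [AddCommGroup M'] [Module ℂ M'] (π' : Sl2 →ₗ⁅ℂ⁆ Module.End ℂ M')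
  (φ : M →ₗ[ℂ] M') (hφ : ∀ x m, φ (π x m) = π' x (φ m))

/-- The map of relaxed Verma modules induced by a homomorphism of `sl₂`-modules. -/
def relaxedMap : RelaxedVerma k Δ π →ₗ[ℂ] RelaxedVerma k Δ π' :=
  inducedLift (Algebra.lsmul ℂ ℂ (RelaxedVerma k Δ π')) (groundMk k Δ π' ∘ₗ φ) (by
    intro a m
    refine Eq.trans ?_ (ι_smul_inducedMk a (φ m)).symm
    refine congrArg (groundMk k Δ π') ?_
    change φ (groundMap k Δ π a m) = groundMap k Δ π' a (φ m)
    simp [groundMap, hφ])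

lemma relaxedMap_groundMk (m : M) :
    relaxedMap k Δ π π' φ hφ (groundMk k Δ π m) = groundMk k Δ π' (φ m) :=
  inducedLift_mk _ _ _ _

lemma relaxedMap_smul (u : UAffine) (v : RelaxedVerma k Δ π) :
    relaxedMap k Δ π π' φ hφ (u • v) = u • relaxedMap k Δ π π' φ hφ v :=
  inducedLift_smul _ _ _ _ _

/-- Both sides kill nonempty words, and on ground states both are `φ`. -/
lemma groundProj_relaxedMap (v : RelaxedVerma k Δ π) :
    groundProj k Δ π' (relaxedMap k Δ π π' φ hφ v) = φ (groundProj k Δ π v) := by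
  induction v using word_induction with
  | word l m =>
    rw [relaxedMap_smul, relaxedMap_groundMk]
    cases l with
    | nil => simp only [wordElt, one_smul, groundProj_mk]
    | cons a l => rw [groundProj_word_cons, groundProj_word_cons, map_zero]
  | add v w hv hw => simp only [map_add, hv, hw]
  | smul c v hv => simp only [map_smul, hv]

include hφ in
/-- The projection to the ground states is natural. -/
lemma groundProj_natural (u : UAffine) (m : M) :
    groundProj k Δ π' (u • groundMk k Δ π' (φ m)) = φ (groundProj k Δ π (u • groundMk k Δ π m)) := by
  rw [← groundProj_relaxedMap k Δ π π' φ hφ, relaxedMap_smul, relaxedMap_groundMk]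

end Functoriality

/-! ### The largest submodule avoiding the ground states -/

/-- The largest submodule in the kernel of the projection to the ground states. -/
def groundKer : Submodule UAffine (RelaxedVerma k Δ π) where
  carrier := {v | ∀ u : UAffine, groundProj k Δ π (u • v) = 0}
  add_mem' := by
    intro v w hv hw u
    rw [smul_add, map_add, hv u, hw u, add_zero]
  zero_mem' := by
    intro u
    rw [smul_zero, map_zero]
  smul_mem' := by
    intro u' v hv u
    rw [← mul_smul]; exact hv _

lemma mem_groundKer (v : RelaxedVerma k Δ π) :
    v ∈ groundKer k Δ π ↔ ∀ u : UAffine, groundProj k Δ π (u • v) = 0 := Iff.rfl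

lemma aeval_smul_of_eigen {V : Type*} [AddCommGroup V] [Module ℂ V] [Module UAffine V]
    [IsScalarTower ℂ UAffine V] (y : UAffine) {v : V} {c : ℂ} (h : y • v = c • v)
    (p : Polynomial ℂ) : Polynomial.aeval y p • v = p.eval c • v := by
  induction p using Polynomial.induction_on' with
  | add p r hp hr => rw [map_add, add_smul, hp, hr, Polynomial.eval_add, add_smul]
  | monomial n a =>
    have hn : y ^ n • v = c ^ n • v := by
      induction n with
      | zero => simp
      | succ n ih =>
        have : y • c ^ n • v = c ^ n • y • v := by
          rw [← algebraMap_smul UAffine (c ^ n) v, ← mul_smul, ← Algebra.commutes, mul_smul,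
            algebraMap_smul]
        rw [pow_succ', mul_smul, ih, this, h, ← mul_smul, pow_succ]
    rw [Polynomial.aeval_monomial, mul_smul, hn, Polynomial.eval_monomial, algebraMap_smul, mul_smul]

/-- The projection to the ground states is given by polynomials in `L₀`. -/
lemma exists_aeval_smul_eq (v : RelaxedVerma k Δ π) : ∃ p : Polynomial ℂ, p.eval Δ = 1 ∧
    Polynomial.aeval (ι ℂ L0 : UAffine) p • v = groundMk k Δ π (groundProj k Δ π v) := by
  have hg (p : Polynomial ℂ) (m : M) : Polynomial.aeval (ι ℂ L0 : UAffine) p • groundMk k Δ π m =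
      p.eval Δ • groundMk k Δ π m := aeval_smul_of_eigen _ (L0_smul_groundMk k Δ π m) p
  induction v using word_induction with
  | word l m =>
    cases l with
    | nil => exact ⟨1, by simp, by simp only [map_one, wordElt, one_smul, groundProj_mk]⟩
    | cons a l =>
      set d : ℂ := (wordDeg (a :: l) : ℂ) with hdef
      have hd : d ≠ 0 := by rw [hdef]; simp only [wordDeg]; exact_mod_cast (by omega)
      -- The linear polynomial with value `1` at `Δ` and a zero at `Δ + d`, the `L₀`-eigenvalue of
      -- the word; `d ≠ 0` because the word is nonempty.
      refine ⟨Polynomial.C (-d⁻¹) * (Polynomial.X - Polynomial.C (Δ + d)), ?_, ?_⟩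
      · simp; field_simp
      · rw [aeval_smul_of_eigen _ (L0_smul_word k Δ π (a :: l) m), groundProj_word_cons, map_zero]
        simp [← hdef]
  | add v w hv hw =>
    obtain ⟨p, hp, hpv⟩ := hv
    obtain ⟨r, hr, hrw⟩ := hw
    -- The product serves both vectors: once one factor has projected to the ground states, the
    -- other acts there as its value `1` at `Δ`.
    refine ⟨p * r, by simp [hp, hr], ?_⟩
    have e1 : Polynomial.aeval (ι ℂ L0 : UAffine) (p * r) • v =
        groundMk k Δ π (groundProj k Δ π v) := by
      rw [mul_comm, map_mul, mul_smul, hpv, hg, hr, one_smul]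
    have e2 : Polynomial.aeval (ι ℂ L0 : UAffine) (p * r) • w =
        groundMk k Δ π (groundProj k Δ π w) := by
      rw [map_mul, mul_smul, hrw, hg, hp, one_smul]
    rw [smul_add, e1, e2, ← map_add, ← map_add]
  | smul c v hv =>
    obtain ⟨p, hp, hpv⟩ := hv
    exact ⟨p, hp, by rw [smul_comm, hpv, ← map_smul, ← map_smul]⟩

/-- A submodule contains the ground component of each of its vectors, since this is obtained by a
polynomial in `L₀`. If it avoids the ground states, all these components vanish. -/
lemma le_groundKer {N : Submodule UAffine (RelaxedVerma k Δ π)}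
    (hN : N.restrictScalars ℂ ⊓ groundStates k Δ π = ⊥) : N ≤ groundKer k Δ π := by
  intro v hv u
  obtain ⟨p, -, hp⟩ := exists_aeval_smul_eq k Δ π (u • v)
  have h : groundMk k Δ π (groundProj k Δ π (u • v)) ∈ N.restrictScalars ℂ ⊓ groundStates k Δ π := by
    refine ⟨?_, ⟨_, rfl⟩⟩
    rw [← hp]
    exact N.smul_mem _ (N.smul_mem _ hv)
  rw [hN, Submodule.mem_bot] at h
  rw [← groundProj_mk k Δ π (groundProj k Δ π (u • v)), h, map_zero]

lemma groundKer_inf : (groundKer k Δ π).restrictScalars ℂ ⊓ groundStates k Δ π = ⊥ := by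
  rw [eq_bot_iff]
  rintro v ⟨hv, m, rfl⟩
  have h := hv 1
  rw [one_smul] at h
  have h' : m = 0 := (groundProj_mk k Δ π m).symm.trans h
  rw [Submodule.mem_bot, h', map_zero]

/-- This turns the quotient into a rank problem: membership becomes the vanishing of ground
components. -/
lemma maxAvoidingGround_eq : maxAvoidingGround k Δ π = groundKer k Δ π :=
  le_antisymm (sSup_le fun _ hN => le_groundKer k Δ π hN) (le_sSup (groundKer_inf k Δ π))

/-- A submodule meets the ground states in an `sl₂`-submodule. If `M` is irreducible this is zero or
everything, and in the latter case the submodule contains generators. -/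
lemma maxProper_eq [Nontrivial M]
    (hirr : ∀ P : Submodule ℂ M, (∀ x, ∀ m ∈ P, π x m ∈ P) → P = ⊥ ∨ P = ⊤) :
    maxProper k Δ π = groundKer k Δ π := by
  apply le_antisymm
  · refine sSup_le fun N hN => le_groundKer k Δ π ?_
    let P : Submodule ℂ M := (N.restrictScalars ℂ).comap (groundMk k Δ π)
    rcases hirr P (fun x m hm => by
      change groundMk k Δ π (π x m) ∈ N
      rw [← mode_zero_smul_groundMk]
      exact N.smul_mem _ hm) with hP | hP
    · rw [eq_bot_iff]
      rintro v ⟨hv, m, rfl⟩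
      have hm : m ∈ P := hv
      rw [hP, Submodule.mem_bot] at hm
      rw [hm, Submodule.mem_bot, map_zero]
    · refine absurd ?_ hN
      rw [eq_top_iff]
      rintro v -
      induction v using induced_induction with
      | mk m =>
        have hm : m ∈ P := by rw [hP]; trivial
        exact hm
      | add v w hv hw => exact N.add_mem hv hw
      | smul c v hv => exact (N.restrictScalars ℂ).smul_mem c hv
      | lie X v hv => exact N.smul_mem _ hv
  · refine le_sSup ?_
    intro h
    obtain ⟨m, hm⟩ := exists_ne (0 : M)
    have hg : groundMk k Δ π m ∈ (groundKer k Δ π).restrictScalars ℂ ⊓ groundStates k Δ π :=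
      ⟨by rw [h]; trivial, m, rfl⟩
    rw [groundKer_inf, Submodule.mem_bot] at hg
    exact hm (by rw [← groundProj_mk k Δ π m, hg, map_zero])

/-! ### Injectivity of zero modes -/

/-- In effect, `y ^ N * X` is a combination of the products `(ad y)^i X * y ^ (N - i)`, and only `i
< d` survive. For `N = l + d` every surviving term keeps at least `l` factors `y` on the right. -/
lemma exists_pow_mul_ι {y : AffineSl2} (d : ℕ) (X : AffineSl2)
    (hX : ((LieAlgebra.ad ℂ AffineSl2 y) ^ d) X = 0) (l : ℕ) :
    ∃ u : UAffine, (ι ℂ y : UAffine) ^ (l + d) * ι ℂ X = u * (ι ℂ y : UAffine) ^ l := by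
  induction d generalizing X l with
  | zero =>
    refine ⟨0, ?_⟩
    have : X = 0 := by simpa using hX
    simp [this]
  | succ d ih =>
    have hY : ((LieAlgebra.ad ℂ AffineSl2 y) ^ d) ⁅y, X⁆ = 0 := by
      rw [pow_succ] at hX; exact hX
    have hcomm : (ι ℂ y : UAffine) * ι ℂ X = ι ℂ X * ι ℂ y + ι ℂ ⁅y, X⁆ := by
      rw [LieHom.map_lie, Ring.lie_def]; abel
    induction l with
    | zero => exact ⟨_, by rw [pow_zero, mul_one]⟩
    | succ l ihl =>
      obtain ⟨u, hu⟩ := ihl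
      obtain ⟨u', hu'⟩ := ih _ hY (l + 1)
      refine ⟨u + u', ?_⟩
      have e : l + 1 + (d + 1) = (l + (d + 1)) + 1 := by ring
      rw [e, pow_succ, mul_assoc, hcomm, mul_add, ← mul_assoc, hu, add_mul, mul_assoc, ← pow_succ]
      rw [show l + (d + 1) = l + 1 + d by ring, hu']

/-- The Ore condition for the powers of `y`. For a product, the exponent produced by the right
factor is the one demanded of the left factor. -/
lemma exists_pow_mul {y : AffineSl2} {d : ℕ}
    (hy : (LieAlgebra.ad ℂ AffineSl2 y) ^ d = 0) (u : UAffine) (l : ℕ) :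
    ∃ (n : ℕ) (u' : UAffine), (ι ℂ y : UAffine) ^ n * u = u' * (ι ℂ y : UAffine) ^ l := by
  induction u using enveloping_induction generalizing l with
  | one => exact ⟨l, 1, by simp⟩
  | add u v hu hv =>
    obtain ⟨n, u', h⟩ := hu l
    obtain ⟨n', v', h'⟩ := hv l
    -- Extra powers on the left bring the two summands to a common exponent.
    refine ⟨n + n', (ι ℂ y) ^ n' * u' + (ι ℂ y) ^ n * v', ?_⟩
    rw [mul_add, add_mul, mul_assoc, ← h, mul_assoc, ← h', ← mul_assoc, ← mul_assoc, ← pow_add,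
      ← pow_add, add_comm n']
  | smul c u hu =>
    obtain ⟨n, u', h⟩ := hu l
    exact ⟨n, c • u', by rw [mul_smul_comm, h, smul_mul_assoc]⟩
  | mul X u hu =>
    obtain ⟨n, u', h⟩ := hu l
    obtain ⟨w, hw⟩ := exists_pow_mul_ι d X (by rw [hy]; rfl) n
    exact ⟨n + d, w * u', by rw [← mul_assoc, hw, mul_assoc, h, mul_assoc]⟩

lemma groundProj_pow_mode_zero (x : Sl2) (n : ℕ) (v : RelaxedVerma k Δ π) :
    groundProj k Δ π ((ι ℂ (mode x 0) : UAffine) ^ n • v) = ((π x) ^ n) (groundProj k Δ π v) := by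
  induction n with
  | zero => simp
  | succ n ih => rw [pow_succ', mul_smul, groundProj_mode_zero, ih, pow_succ']; rfl

/-- If `x` acts injectively on `M` and `x₀` is ad-nilpotent, then `x₀` acts injectively on the
quotient by the largest submodule avoiding the ground states. -/
lemma mem_groundKer_of_mode_zero_smul_mem {x : Sl2} {d : ℕ}
    (hx : (LieAlgebra.ad ℂ AffineSl2 (mode x 0)) ^ d = 0) (hinj : Function.Injective (π x))
    {v : RelaxedVerma k Δ π} (hv : ι ℂ (mode x 0) • v ∈ groundKer k Δ π) : v ∈ groundKer k Δ π := by
  intro u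
  -- As `x₀ⁿ u v = u' x₀ v` lies in the radical, `π(x)ⁿ` kills the ground component of `u v`;
  -- injectivity of `π x` then makes that component zero.
  obtain ⟨n, u', h⟩ := exists_pow_mul hx u 1
  have h1 : ((π x) ^ n) (groundProj k Δ π (u • v)) = 0 := by
    rw [← groundProj_pow_mode_zero, ← mul_smul, h, pow_one, mul_smul]
    exact hv u'
  have h2 : Function.Injective ((π x) ^ n) := by
    rw [Module.End.coe_pow]; exact hinj.iterate n
  exact h2 (by rw [h1, map_zero])

lemma ad_mode_zero_pow_eq_zero {x : Sl2} (hx : ∀ y : Sl2, ⁅x, ⁅x, ⁅x, y⁆⁆⁆ = 0) :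
    (LieAlgebra.ad ℂ AffineSl2 (mode x 0)) ^ 3 = 0 := by
  have h0 (y : Sl2) (n : ℤ) : ⁅mode x 0, mode y n⁆ = mode ⁅x, y⁆ n := by
    rw [mode_lie_mode]
    simp
  refine LinearMap.ext fun X => ?_
  rw [pow_succ, pow_two, Module.End.mul_apply, Module.End.mul_apply, LieAlgebra.ad_apply,
    LieAlgebra.ad_apply, LieAlgebra.ad_apply, LinearMap.zero_apply]
  induction X using affine_induction with
  | add X Y h h' => simp only [lie_add, h, h', add_zero]
  | smul c X h => simp only [lie_smul, h, smul_zero]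
  | hK => rw [lie_K, lie_zero, lie_zero]
  | hL0 => rw [mode_lie_L0]; simp
  | hmode y n => rw [h0, h0, h0, hx, ← modeMap_apply, map_zero]

lemma sl2e_ad_nilpotent (y : Sl2) : ⁅sl2e, ⁅sl2e, ⁅sl2e, y⁆⁆⁆ = 0 := by
  obtain ⟨h1, h2, h3⟩ := sl2_relations
  have h4 : ⁅sl2e, sl2h⁆ = -((2 : ℂ) • sl2e) := by rw [← h1, lie_skew]
  rw [sl2_eq_sum y]
  simp [h2, h4]

lemma sl2f_ad_nilpotent (y : Sl2) : ⁅sl2f, ⁅sl2f, ⁅sl2f, y⁆⁆⁆ = 0 := by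
  obtain ⟨h1, h2, h3⟩ := sl2_relations
  have h4 : ⁅sl2f, sl2h⁆ = -((-2 : ℂ) • sl2f) := by rw [← h3, lie_skew]
  have h5 : ⁅sl2f, sl2e⁆ = -sl2h := by rw [← h2, lie_skew]
  rw [sl2_eq_sum y]
  simp [h5, h4]

end Words

/-! ### Linear algebra -/

section LinearAlgebra

open Module

/-- Linearly independent functions are separated by evaluation at finitely many points. -/
lemma exists_det_ne_zero {I : Type*} {r : ℕ} {x : Fin r → I → ℂ} (hx : LinearIndependent ℂ x) :
    ∃ c : Fin r → I, (Matrix.of fun s t => x s (c t)).det ≠ 0 := by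
  set Y : Set (Fin r → ℂ) := Set.range fun i s => x s i with hY
  have hspan : Submodule.span ℂ Y = ⊤ := by
    by_contra hne
    -- A functional vanishing on all evaluation vectors is a linear relation among the functions `x
    -- s`.
    obtain ⟨f, hf0, hf⟩ := Submodule.exists_le_ker_of_lt_top _ (lt_top_iff_ne_top.mpr hne)
    apply hf0
    have hsum : ∑ s, f (Pi.single s 1) • x s = 0 := by
      ext i
      have h1 : f (fun s => x s i) = 0 := hf (Submodule.subset_span ⟨i, rfl⟩)
      rw [LinearMap.pi_apply_eq_sum_univ f] at h1
      simp only [Finset.sum_apply, Pi.smul_apply, Pi.zero_apply]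
      rw [← h1]
      refine Finset.sum_congr rfl fun s _ => ?_
      rw [smul_eq_mul, smul_eq_mul, mul_comm]
      congr 2
      ext j
      simp [Pi.single_apply, eq_comm]
    have h0 := Fintype.linearIndependent_iff.mp hx _ hsum
    ext s
    simpa using h0 s
  obtain ⟨f, hfY, -, hf⟩ := Submodule.exists_fun_fin_finrank_span_eq ℂ Y
  have hr : finrank ℂ (Submodule.span ℂ Y) = r := by rw [hspan]; simp
  have hc (t : Fin r) : ∃ i, (fun s => x s i) = f (Fin.cast hr.symm t) := hfY _
  choose c hc using hc
  refine ⟨c, ?_⟩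
  have hli : LinearIndependent ℂ (Matrix.of fun s t => x s (c t)).col := by
    have := hf.comp (Fin.cast hr.symm) (Fin.cast_injective _)
    have e : (Matrix.of fun s t => x s (c t)).col = f ∘ Fin.cast hr.symm := by
      ext t s
      exact congrFun (hc t) s
    rwa [e]
  rw [Matrix.linearIndependent_cols_iff_isUnit, Matrix.isUnit_iff_isUnit_det] at hli
  exact hli.ne_zero

/-- The rank of a matrix of polynomials (with finitely many rows) is bounded by its generic value,
which is attained by the specialisations of a nonzero minor. -/
lemma exists_generic_rank {J I : Type*} [Finite J] (C : J → I → Polynomial ℂ) :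
    ∃ (r : ℕ) (e : Fin r → J) (c : Fin r → I),
      (Matrix.of fun s t => C (e s) (c t)).det ≠ 0 ∧
      ∀ a : ℂ, finrank ℂ (Submodule.span ℂ (Set.range fun j i => (C j i).eval a)) ≤ r := by
  set R : ℂ → ℕ := fun a => finrank ℂ (Submodule.span ℂ (Set.range fun j i => (C j i).eval a))
    with hR
  have hbdd : BddAbove (Set.range R) := by
    have := Fintype.ofFinite J
    refine ⟨Fintype.card J, ?_⟩
    rintro _ ⟨a, rfl⟩
    exact finrank_range_le_card _
  -- The ranks are bounded by the number of rows, so a maximal one is attained, at `a`. A minor that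
  -- is nonzero at `a` is nonzero as a polynomial.
  obtain ⟨a, ha⟩ := Nat.sSup_mem (Set.range_nonempty R) hbdd
  have : FiniteDimensional ℂ
      (Submodule.span ℂ (Set.range fun (j : J) (i : I) => (C j i).eval a)) :=
    FiniteDimensional.span_of_finite ℂ (Set.finite_range _)
  obtain ⟨f, hfY, -, hf⟩ := Submodule.exists_fun_fin_finrank_span_eq ℂ
    (Set.range fun (j : J) (i : I) => (C j i).eval a)
  choose e he using hfY
  obtain ⟨c, hc⟩ := exists_det_ne_zero hf
  refine ⟨R a, e, c, ?_, fun a' => ?_⟩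
  · intro h0
    apply hc
    have := congrArg (Polynomial.eval a) h0
    rw [Polynomial.eval_zero, ← Polynomial.coe_evalRingHom, RingHom.map_det] at this
    rw [← this]
    congr 1
    ext s t
    simp [← he]
  · rw [ha]
    exact le_csSup hbdd ⟨a', rfl⟩

/-- Rank–nullity on `J →₀ ℂ`: the family with more relations has the smaller span. -/
lemma finrank_span_range_le {J V W : Type*} [Finite J] [AddCommGroup V] [Module ℂ V]
    [AddCommGroup W] [Module ℂ W] (x : J → V) (y : J → W)
    (h : ∀ c : J →₀ ℂ, Finsupp.linearCombination ℂ y c = 0 → Finsupp.linearCombination ℂ x c = 0) :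
    finrank ℂ (Submodule.span ℂ (Set.range x)) ≤ finrank ℂ (Submodule.span ℂ (Set.range y)) := by
  rw [← Finsupp.range_linearCombination, ← Finsupp.range_linearCombination]
  have h1 := LinearMap.finrank_range_add_finrank_ker (Finsupp.linearCombination ℂ x)
  have h2 := LinearMap.finrank_range_add_finrank_ker (Finsupp.linearCombination ℂ y)
  have h3 : finrank ℂ (LinearMap.ker (Finsupp.linearCombination ℂ y)) ≤
      finrank ℂ (LinearMap.ker (Finsupp.linearCombination ℂ x)) :=
    Submodule.finrank_mono fun c hc => h c hc
  omega

lemma le_finrank_span_range {J V : Type*} [Finite J] [AddCommGroup V] [Module ℂ V] {r : ℕ}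
    (x : J → V) (e : Fin r → J) (φ : V →ₗ[ℂ] Fin r → ℂ)
    (h : (Matrix.of fun s => φ (x (e s))).det ≠ 0) :
    r ≤ finrank ℂ (Submodule.span ℂ (Set.range x)) := by
  have hli : LinearIndependent ℂ (Matrix.of fun s => φ (x (e s))).row := by
    rw [Matrix.linearIndependent_rows_iff_isUnit, Matrix.isUnit_iff_isUnit_det]
    exact h.isUnit
  have hli' : LinearIndependent ℂ fun s => x (e s) := LinearIndependent.of_comp φ hli
  have hsub := finrank_span_eq_card hli'
  rw [Fintype.card_fin] at hsub
  rw [← hsub]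
  have : FiniteDimensional ℂ (Submodule.span ℂ (Set.range x)) :=
    FiniteDimensional.span_of_finite ℂ (Set.finite_range x)
  refine Submodule.finrank_mono (Submodule.span_mono ?_)
  rintro _ ⟨s, rfl⟩
  exact ⟨e s, rfl⟩

/-- If a module is spanned by a set `X` of simultaneous eigenvectors, then its simultaneous
generalised eigenspaces are spanned by the elements of `X` they contain. -/
lemma maxGenEigenspace_inf_eq_span {V : Type*} [AddCommGroup V] [Module ℂ V] {A B : Module.End ℂ V}
    (hAB : Commute A B) {X : Set V} (hX : Submodule.span ℂ X = ⊤)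
    (heig : ∀ x ∈ X, ∃ a b : ℂ, A x = a • x ∧ B x = b • x) (a b : ℂ) :
    A.maxGenEigenspace a ⊓ B.maxGenEigenspace b =
      Submodule.span ℂ {x ∈ X | A x = a • x ∧ B x = b • x} := by
  set f : Bool → Module.End ℂ V := fun i => cond i A B with hf
  set w : (Bool → ℂ) → Submodule ℂ V := fun χ => ⨅ i, (f i).maxGenEigenspace (χ i) with hw
  set G : (Bool → ℂ) → Submodule ℂ V := fun χ =>
    Submodule.span ℂ {x ∈ X | A x = χ true • x ∧ B x = χ false • x} with hG
  have hcomm (i j : Bool) : Commute (f i) (f j) := by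
    cases i <;> cases j
    · exact Commute.refl _
    · exact hAB.symm
    · exact hAB
    · exact Commute.refl _
  have hind : iSupIndep w := Module.End.independent_iInf_maxGenEigenspace_of_forall_mapsTo f
    fun i j φ => Module.End.mapsTo_maxGenEigenspace_of_comm (hcomm j i) φ
  have hw' (χ : Bool → ℂ) :
      w χ = A.maxGenEigenspace (χ true) ⊓ B.maxGenEigenspace (χ false) := by
    simp only [hw, iInf_bool_eq, hf, cond_true, cond_false]
  have hle (χ : Bool → ℂ) : G χ ≤ w χ := by
    rw [hw', hG, Submodule.span_le]
    rintro x ⟨-, h1, h2⟩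
    exact ⟨(Module.End.mem_maxGenEigenspace _ _ _).mpr ⟨1, by simp [h1]⟩,
      (Module.End.mem_maxGenEigenspace _ _ _).mpr ⟨1, by simp [h2]⟩⟩
  have htop : ⨆ χ, G χ = ⊤ := by
    rw [eq_top_iff, ← hX, Submodule.span_le]
    intro x hx
    obtain ⟨a, b, h⟩ := heig x hx
    exact Submodule.mem_iSup_of_mem (fun i : Bool => cond i a b) (Submodule.subset_span ⟨hx, h⟩)
  set χ : Bool → ℂ := fun i => cond i a b with hχ
  have key : w χ ≤ G χ := by
    -- The subspaces `G χ ≤ w χ` already sum to everything while the `w χ` are independent, so the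
    -- modular law forces `G χ = w χ`.
    have h1 : G χ ⊔ ⨆ χ' ≠ χ, w χ' = ⊤ := by
      rw [eq_top_iff, ← htop]
      refine iSup_le fun χ' => ?_
      by_cases h : χ' = χ
      · rw [h]; exact le_sup_left
      · exact (hle χ').trans ((le_iSup₂ (f := fun χ' (_ : χ' ≠ χ) => w χ') χ' h).trans le_sup_right)
    have h2 : (G χ ⊔ ⨆ χ' ≠ χ, w χ') ⊓ w χ = G χ ⊔ (⨆ χ' ≠ χ, w χ') ⊓ w χ :=
      (sup_inf_assoc_of_le _ (hle χ))
    rw [h1, top_inf_eq, inf_comm, (hind χ).eq_bot, sup_bot_eq] at h2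
    exact h2.le
  exact (hw' χ).symm.trans (le_antisymm key (hle χ))

/-- The commutation relation says that `F` intertwines `A - a` with `A - (a + c)`, hence also their
powers. -/
lemma mem_maxGenEigenspace_of_commutator {V : Type*} [AddCommGroup V] [Module ℂ V]
    {A F : Module.End ℂ V} {c : ℂ} (h : A * F = F * A + c • F) {a : ℂ} {v : V}
    (hv : v ∈ A.maxGenEigenspace a) : F v ∈ A.maxGenEigenspace (a + c) := by
  rw [Module.End.mem_maxGenEigenspace] at hv ⊢
  obtain ⟨n, hn⟩ := hv
  refine ⟨n, ?_⟩
  have h1 : SemiconjBy F (A - a • 1) (A - (a + c) • 1) := by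
    change F * (A - a • 1) = (A - (a + c) • 1) * F
    rw [sub_mul, mul_sub, h, add_smul, add_mul, smul_mul_assoc, smul_mul_assoc, mul_smul_comm,
      one_mul, mul_one]
    abel
  have h2 := congrArg (fun g : Module.End ℂ V => g v) (h1.pow_right n).eq
  simp only [Module.End.mul_apply, hn, map_zero] at h2
  exact h2.symm

end LinearAlgebra

/-! ### Weight spaces -/

section Chains

open AffineSl2 Module
open UniversalEnvelopingAlgebra (ι)

variable {M : Type*} [AddCommGroup M] [Module ℂ M] (k Δ q : ℂ) (π : Sl2 →ₗ⁅ℂ⁆ Module.End ℂ M)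

/-- A spanning family `b` of weight vectors of an `sl₂`-module on which `sl₂` acts by the formulas
of the dense modules of Casimir eigenvalue `q`. -/
structure WeightChain (a : ℂ) (b : ℤ → M) : Prop where
  -- Linear independence is not demanded: in the lowest-weight case the vectors `b i` with `i ≤ 0`
  -- are zero.
  span_eq_top : Submodule.span ℂ (Set.range b) = ⊤
  map_h : ∀ i, π sl2h (b i) = (a + i * simpleRoot) • b i
  map_e : ∀ i, π sl2e (b i) = denseCoeff q (a + i * simpleRoot) • b (i + 1)
  map_f : ∀ i, π sl2f (b i) = b (i - 1)

/-- The vector obtained by applying a word to a member of the family `b`, with weight `a + mα`. -/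
def chainVec (b : ℤ → M) (m : ℤ) (l : List (Fin 3 × ℕ)) : RelaxedVerma k Δ π :=
  wordElt l • groundMk k Δ π (b (m - wordRoot l))

instance (N : ℕ) : Finite {l : List (Fin 3 × ℕ) // wordDeg l = N} :=
  (finite_wordDeg_eq N).to_subtype

section Quotient

variable {q π} {a : ℂ} {b : ℤ → M} (hb : WeightChain q π a b)
  (N : Submodule UAffine (RelaxedVerma k Δ π))

lemma commute_act_mode_zero_L0 (V : Type*) [AddCommGroup V] [Module ℂ V] [Module UAffine V]
    [IsScalarTower ℂ UAffine V] : Commute (act V (mode sl2h 0)) (act V L0) := by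
  refine LinearMap.ext fun v => ?_
  change ι ℂ (mode sl2h 0) • ι ℂ L0 • v = ι ℂ L0 • ι ℂ (mode sl2h 0) • v
  rw [ι_smul_comm, mode_lie_L0]
  simp

include hb

lemma span_chainVec (N : Submodule UAffine (RelaxedVerma k Δ π)) :
    Submodule.span ℂ (Set.range fun p : ℤ × List (Fin 3 × ℕ) =>
      N.mkQ (chainVec k Δ π b p.1 p.2)) = ⊤ := by
  set T := Submodule.span ℂ (Set.range fun p : ℤ × List (Fin 3 × ℕ) =>
      N.mkQ (chainVec k Δ π b p.1 p.2)) with hT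
  rw [eq_top_iff]
  rintro v -
  induction v using Submodule.Quotient.induction_on with
  | H v =>
    change N.mkQ v ∈ T
    induction v using word_induction with
    | word l m =>
      have hm : m ∈ Submodule.span ℂ (Set.range b) := by rw [hb.span_eq_top]; trivial
      induction hm using Submodule.span_induction with
      | zero => simp
      | add m m' _ _ h h' => simp only [map_add, smul_add] at h h' ⊢; exact add_mem h h'
      | smul c m _ h =>
        rw [(groundMk k Δ π).map_smul, smul_comm (wordElt l) c, LinearMap.map_smul_of_tower]
        exact T.smul_mem c h
      | mem m hm =>
        obtain ⟨i, rfl⟩ := hm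
        refine Submodule.subset_span ⟨(i + wordRoot l, l), ?_⟩
        simp only [chainVec, add_sub_cancel_right]
    | add v w hv hw => rw [map_add]; exact add_mem hv hw
    | smul c v hv => rw [LinearMap.map_smul_of_tower]; exact T.smul_mem c hv

lemma act_h0_chainVec (m : ℤ) (l : List (Fin 3 × ℕ)) :
    act (RelaxedVerma k Δ π ⧸ N) (mode sl2h 0) (N.mkQ (chainVec k Δ π b m l)) =
      (a + m * simpleRoot) • N.mkQ (chainVec k Δ π b m l) := by
  change ι ℂ (mode sl2h 0) • N.mkQ (chainVec k Δ π b m l) = _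
  rw [← map_smul, ← LinearMap.map_smul_of_tower, chainVec, h0_smul_word k Δ π l (hb.map_h _)]
  congr 2
  simp only [simpleRoot]
  push_cast
  ring

omit hb in
lemma act_L0_chainVec (m : ℤ) (l : List (Fin 3 × ℕ)) :
    act (RelaxedVerma k Δ π ⧸ N) L0 (N.mkQ (chainVec k Δ π b m l)) =
      (Δ + wordDeg l) • N.mkQ (chainVec k Δ π b m l) := by
  change ι ℂ L0 • N.mkQ (chainVec k Δ π b m l) = _
  rw [← map_smul, ← LinearMap.map_smul_of_tower, chainVec, L0_smul_word k Δ π l]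

lemma weightSpace_eq_span (ν n : ℂ) : weightSpace (RelaxedVerma k Δ π ⧸ N) ν n =
    Submodule.span ℂ {x ∈ Set.range fun p : ℤ × List (Fin 3 × ℕ) =>
      N.mkQ (chainVec k Δ π b p.1 p.2) | act (RelaxedVerma k Δ π ⧸ N) (mode sl2h 0) x = ν • x ∧
        act (RelaxedVerma k Δ π ⧸ N) L0 x = n • x} := by
  refine maxGenEigenspace_inf_eq_span (commute_act_mode_zero_L0 _) (span_chainVec k Δ hb N) ?_ ν n
  rintro _ ⟨p, rfl⟩
  exact ⟨_, _, act_h0_chainVec k Δ hb N _ _, act_L0_chainVec k Δ N _ _⟩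

/-- The weight spaces of a quotient of a relaxed Verma module are spanned by words. -/
theorem weightSpace_quotient (m : ℤ) (d : ℕ) :
    weightSpace (RelaxedVerma k Δ π ⧸ N) (a + m * simpleRoot) (Δ + d) =
      Submodule.span ℂ (Set.range fun l : {l : List (Fin 3 × ℕ) // wordDeg l = d} =>
        N.mkQ (chainVec k Δ π b m l.1)) := by
  rw [weightSpace_eq_span k Δ hb N]
  apply le_antisymm
  · rw [Submodule.span_le]
    rintro _ ⟨⟨⟨m', l⟩, rfl⟩, h1, h2⟩
    by_cases h0 : N.mkQ (chainVec k Δ π b m' l) = 0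
    -- A vanishing word vector satisfies every eigenvalue equation, so only nonzero ones determine
    -- `m` and `d`.
    · simp only [h0]; exact zero_mem _
    · simp only [act_h0_chainVec k Δ hb N, act_L0_chainVec k Δ N] at h1 h2
      have e1 := smul_left_injective ℂ h0 h1
      have e2 := smul_left_injective ℂ h0 h2
      have e1' : m' = m := by
        have : (m' : ℂ) * 2 = m * 2 := add_left_cancel e1
        exact_mod_cast mul_right_cancel₀ two_ne_zero this
      have e2' : wordDeg l = d := by exact_mod_cast add_left_cancel e2
      subst e1'
      exact Submodule.subset_span ⟨⟨l, e2'⟩, rfl⟩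
  · refine Submodule.span_mono ?_
    rintro _ ⟨⟨l, rfl⟩, rfl⟩
    exact ⟨⟨(m, l), rfl⟩, act_h0_chainVec k Δ hb N _ _, act_L0_chainVec k Δ N _ _⟩

lemma weightSpace_quotient_eq_bot {ν n : ℂ}
    (h : ∀ (m : ℤ) (d : ℕ), ν = a + m * simpleRoot → n ≠ Δ + d) :
    weightSpace (RelaxedVerma k Δ π ⧸ N) ν n = ⊥ := by
  rw [weightSpace_eq_span k Δ hb N, eq_bot_iff, Submodule.span_le]
  rintro _ ⟨⟨⟨m', l⟩, rfl⟩, h1, h2⟩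
  by_contra h0
  simp only [act_h0_chainVec k Δ hb N, act_L0_chainVec k Δ N] at h1 h2
  exact h m' (wordDeg l) (smul_left_injective ℂ h0 h1).symm (smul_left_injective ℂ h0 h2).symm

lemma finiteDimensional_weightSpace_quotient (ν n : ℂ) :
    FiniteDimensional ℂ (weightSpace (RelaxedVerma k Δ π ⧸ N) ν n) := by
  by_cases h : ∀ (m : ℤ) (d : ℕ), ν = a + m * simpleRoot → n ≠ Δ + d
  · rw [weightSpace_quotient_eq_bot k Δ hb N h]; infer_instance
  · push Not at h
    obtain ⟨m, d, rfl, rfl⟩ := h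
    rw [weightSpace_quotient k Δ hb N]
    exact FiniteDimensional.span_of_finite ℂ (Set.finite_range _)

end Quotient

/-! ### The universal dense module -/

/-- The space `⨁ ℂ[X] vᵢ` of the dense module with indeterminate weight. -/
abbrev UnivSpace : Type := ℤ →₀ Polynomial ℂ

/-- The polynomial `γ(X + iα)`. -/
def univCoeff (i : ℤ) : Polynomial ℂ :=
  Polynomial.C 2⁻¹ * (Polynomial.C q - Polynomial.C 2⁻¹ *
    (Polynomial.X + Polynomial.C ((i : ℂ) * simpleRoot)) *
    (Polynomial.X + Polynomial.C ((i : ℂ) * simpleRoot) + Polynomial.C 2))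

lemma eval_univCoeff (i : ℤ) (a : ℂ) :
    (univCoeff q i).eval a = denseCoeff q (a + i * simpleRoot) := by
  simp only [univCoeff, denseCoeff, bilin, weylVector, Polynomial.eval_mul, Polynomial.eval_sub,
    Polynomial.eval_add, Polynomial.eval_C, Polynomial.eval_X]
  ring

/-- `e vᵢ = γ(X + iα) vᵢ₊₁`. -/
def univE : Module.End ℂ UnivSpace :=
  Finsupp.lsum ℂ fun i => Finsupp.lsingle (i + 1) ∘ₗ LinearMap.mulLeft ℂ (univCoeff q i)

/-- `h vᵢ = (X + iα)(h) vᵢ`. -/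
def univH : Module.End ℂ UnivSpace :=
  Finsupp.lsum ℂ fun i => Finsupp.lsingle i ∘ₗ
    LinearMap.mulLeft ℂ (Polynomial.X + Polynomial.C ((i : ℂ) * simpleRoot))

/-- `f vᵢ = vᵢ₋₁`. -/
def univF : Module.End ℂ UnivSpace := Finsupp.lsum ℂ fun i => Finsupp.lsingle (i - 1)

lemma univE_single (i : ℤ) (p : Polynomial ℂ) :
    univE q (Finsupp.single i p) = Finsupp.single (i + 1) (univCoeff q i * p) := by
  simp [univE]

lemma univH_single (i : ℤ) (p : Polynomial ℂ) : univH (Finsupp.single i p) =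
    Finsupp.single i ((Polynomial.X + Polynomial.C ((i : ℂ) * simpleRoot)) * p) := by
  simp [univH]

lemma univF_single (i : ℤ) (p : Polynomial ℂ) :
    univF (Finsupp.single i p) = Finsupp.single (i - 1) p := by
  simp [univF]

/-- The dense module of Casimir eigenvalue `q` with indeterminate weight. -/
def univRep : Sl2 →ₗ⁅ℂ⁆ Module.End ℂ UnivSpace :=
  sl2Rep (univE q) univH univF
    (by
      refine Finsupp.lhom_ext fun i p => ?_
      simp only [LinearMap.sub_apply, LinearMap.smul_apply, Module.End.mul_apply, univE_single,
        univH_single, Finsupp.smul_single, ← Finsupp.single_sub]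
      congr 1
      simp only [simpleRoot, Polynomial.smul_eq_C_mul]
      push_cast
      simp only [add_mul, Polynomial.C_add, one_mul]
      ring)
    (by
      refine Finsupp.lhom_ext fun i p => ?_
      simp only [LinearMap.sub_apply, Module.End.mul_apply, univE_single, univF_single,
        univH_single, sub_add_cancel, add_sub_cancel_right, ← Finsupp.single_sub]
      congr 1
      rw [← sub_mul]
      congr 1
      refine Polynomial.funext fun x => ?_
      simp only [Polynomial.eval_sub, eval_univCoeff, denseCoeff, bilin, weylVector, simpleRoot,
        Polynomial.eval_add, Polynomial.eval_X, Polynomial.eval_C]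
      push_cast
      ring)
    (by
      refine Finsupp.lhom_ext fun i p => ?_
      simp only [LinearMap.sub_apply, LinearMap.smul_apply, Module.End.mul_apply, univF_single,
        univH_single, Finsupp.smul_single, ← Finsupp.single_sub]
      congr 1
      simp only [simpleRoot, Polynomial.smul_eq_C_mul]
      push_cast
      simp only [sub_mul, Polynomial.C_sub, one_mul]
      rw [Polynomial.C_neg]
      ring)

lemma sl2Rep_apply {E H F : Module.End ℂ M} (hHE : H * E - E * H = (2 : ℂ) • E)
    (hEF : E * F - F * E = H) (hHF : H * F - F * H = (-2 : ℂ) • F) (x : Sl2) :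
    sl2Rep E H F hHE hEF hHF x = x.1 0 1 • E + x.1 0 0 • H + x.1 1 0 • F := rfl

lemma sl2Rep_e {E H F : Module.End ℂ M} (hHE : H * E - E * H = (2 : ℂ) • E)
    (hEF : E * F - F * E = H) (hHF : H * F - F * H = (-2 : ℂ) • F) :
    sl2Rep E H F hHE hEF hHF sl2e = E := by
  simp [sl2Rep_apply, sl2e]

lemma sl2Rep_h {E H F : Module.End ℂ M} (hHE : H * E - E * H = (2 : ℂ) • E)
    (hEF : E * F - F * E = H) (hHF : H * F - F * H = (-2 : ℂ) • F) :
    sl2Rep E H F hHE hEF hHF sl2h = H := by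
  simp [sl2Rep_apply, sl2h]

lemma sl2Rep_f {E H F : Module.End ℂ M} (hHE : H * E - E * H = (2 : ℂ) • E)
    (hEF : E * F - F * E = H) (hHF : H * F - F * H = (-2 : ℂ) • F) :
    sl2Rep E H F hHE hEF hHF sl2f = F := by
  simp [sl2Rep_apply, sl2f]

/-- The specialisation `X ↦ a + mα`, `vᵢ ↦ b (m + i)`. -/
def specialise (a : ℂ) (b : ℤ → M) (m : ℤ) : UnivSpace →ₗ[ℂ] M :=
  Finsupp.lsum ℂ fun i => (Polynomial.leval (a + m * simpleRoot)).smulRight (b (m + i))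

lemma specialise_apply (a : ℂ) (b : ℤ → M) (m : ℤ) (v : UnivSpace) :
    specialise a b m v = v.sum fun i p => p.eval (a + m * simpleRoot) • b (m + i) := by
  simp [specialise, Finsupp.lsum_apply]

lemma specialise_single (a : ℂ) (b : ℤ → M) (m i : ℤ) (p : Polynomial ℂ) :
    specialise a b m (Finsupp.single i p) = p.eval (a + m * simpleRoot) • b (m + i) := by
  simp [specialise]

/-- At `X = a + mα` the weight `X + iα` of the universal module becomes the weight of `b (m + i)`,
so the formulas of `WeightChain` are the evaluated universal ones. -/
lemma specialise_rep {q : ℂ} {π : Sl2 →ₗ⁅ℂ⁆ Module.End ℂ M} {a : ℂ} {b : ℤ → M}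
    (hb : WeightChain q π a b) (m : ℤ) (x : Sl2) (v : UnivSpace) :
    specialise a b m (univRep q x v) = π x (specialise a b m v) := by
  induction v using Finsupp.induction_linear with
  | zero => simp
  | add v w hv hw => simp only [map_add, hv, hw]
  | single i p =>
    have hπ : π x = x.1 0 1 • π sl2e + x.1 0 0 • π sl2h + x.1 1 0 • π sl2f := by
      conv_lhs => rw [sl2_eq_sum x]
      simp
    rw [hπ, univRep, sl2Rep_apply]
    simp only [LinearMap.add_apply, LinearMap.smul_apply, map_add, map_smul, univE_single,
      univH_single, univF_single, specialise_single, hb.map_e, hb.map_f, hb.map_h,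
      Polynomial.eval_mul, eval_univCoeff, Polynomial.eval_add, Polynomial.eval_X,
      Polynomial.eval_C]
    have e1 : m + (i + 1) = m + i + 1 := by ring
    have e2 : m + (i - 1) = m + i - 1 := by ring
    have e3 : a + (m : ℂ) * simpleRoot + i * simpleRoot = a + ((m + i : ℤ) : ℂ) * simpleRoot := by
      push_cast; ring
    rw [e1, e2, e3]
    module

/-! ### Ranks of weight spaces -/

/-- The matrix coefficients of the pairing of words with `U`, as polynomials in the weight. -/
def pairing (l : List (Fin 3 × ℕ)) (c : UAffine × ℤ) : Polynomial ℂ :=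
  groundProj k Δ (univRep q) (c.1 • wordElt l •
    -- Starting at index `-wordRoot l` gives all rows the same total weight `X`.
    groundMk k Δ (univRep q) (Finsupp.single (-wordRoot l) 1)) c.2

variable {q π} {a : ℂ} {b : ℤ → M} (hb : WeightChain q π a b)

include hb

/-- Naturality of the ground projection along `specialise`: one polynomial computation governs every
module with a `WeightChain`. -/
lemma groundProj_smul_chainVec (u : UAffine) (m : ℤ) (l : List (Fin 3 × ℕ)) :
    groundProj k Δ π (u • chainVec k Δ π b m l) = specialise a b m (groundProj k Δ (univRep q)
      (u • wordElt l • groundMk k Δ (univRep q) (Finsupp.single (-wordRoot l) 1))) := by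
  have h : b (m - wordRoot l) = specialise a b m (Finsupp.single (-wordRoot l) 1) := by
    simp [specialise_single, sub_eq_add_neg]
  rw [chainVec, h, ← mul_smul, ← mul_smul]
  exact groundProj_natural k Δ (univRep q) π _ (specialise_rep hb m) _ _

/-- A relation among the evaluated rows makes all ground components of the corresponding combination
of words vanish, so the combination dies in the quotient. -/
lemma finrank_weightSpace_le (m : ℤ) (d : ℕ) :
    finrank ℂ (weightSpace (RelaxedVerma k Δ π ⧸ groundKer k Δ π) (a + m * simpleRoot) (Δ + d)) ≤
      finrank ℂ (Submodule.span ℂ (Set.range fun (l : {l : List (Fin 3 × ℕ) // wordDeg l = d}) c =>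
        (pairing k Δ q l.1 c).eval (a + m * simpleRoot))) := by
  rw [weightSpace_quotient k Δ hb]
  refine finrank_span_range_le _ _ fun c hc => ?_
  have key : Finsupp.linearCombination ℂ
      (fun l : {l : List (Fin 3 × ℕ) // wordDeg l = d} => chainVec k Δ π b m l.1) c ∈
        groundKer k Δ π := by
    intro u
    set P : UnivSpace := c.sum fun l z => z • groundProj k Δ (univRep q)
      (u • wordElt l.1 • groundMk k Δ (univRep q) (Finsupp.single (-wordRoot l.1) 1)) with hP
    have h1 : groundProj k Δ π (u • Finsupp.linearCombination ℂ
        (fun l : {l : List (Fin 3 × ℕ) // wordDeg l = d} => chainVec k Δ π b m l.1) c) =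
          specialise a b m P := by
      rw [Finsupp.linearCombination_apply, Finsupp.sum, Finset.smul_sum, map_sum, hP, Finsupp.sum,
        map_sum]
      refine Finset.sum_congr rfl fun l _ => ?_
      rw [smul_comm, LinearMap.map_smul, groundProj_smul_chainVec k Δ hb, LinearMap.map_smul]
    rw [h1, specialise_apply]
    refine Finset.sum_eq_zero fun i _ => ?_
    have h2 := congrFun hc (u, i)
    rw [Finsupp.linearCombination_apply, Finsupp.sum, Finset.sum_apply] at h2
    have h3 : (P i).eval (a + m * simpleRoot) = 0 := by
      rw [hP, Finsupp.sum, Finsupp.finsetSum_apply, Polynomial.eval_finsetSum]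
      refine Eq.trans (Finset.sum_congr rfl fun l _ => ?_) h2
      rw [Finsupp.smul_apply, Polynomial.eval_smul]
      rfl
    simp only [h3, zero_smul]
  have h4 : (groundKer k Δ π).mkQ (Finsupp.linearCombination ℂ
      (fun l : {l : List (Fin 3 × ℕ) // wordDeg l = d} => chainVec k Δ π b m l.1) c) = 0 := by
    rwa [← LinearMap.mem_ker, Submodule.ker_mkQ]
  rw [← h4, Finsupp.linearCombination_apply, Finsupp.linearCombination_apply, Finsupp.sum,
    Finsupp.sum, map_sum]
  refine Finset.sum_congr rfl fun l _ => ?_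
  rw [LinearMap.map_smul_of_tower]

/-- The upper bound can be strict, since a coefficient of a vanishing `b i` is invisible. The
functionals `β` guarantee that the columns of the chosen minor are visible in the module. -/
lemma le_finrank_weightSpace (m : ℤ) (d r : ℕ)
    (e : Fin r → {l : List (Fin 3 × ℕ) // wordDeg l = d}) (c : Fin r → UAffine × ℤ)
    (hdet : (Matrix.of fun s t => pairing k Δ q (e s).1 (c t)).det.eval (a + m * simpleRoot) ≠ 0)
    (β : Fin r → M →ₗ[ℂ] ℂ)
    (hβ : ∀ t i, β t (b (m + i)) = if i = (c t).2 then 1 else 0) :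
    r ≤ finrank ℂ (weightSpace (RelaxedVerma k Δ π ⧸ groundKer k Δ π) (a + m * simpleRoot)
      (Δ + d)) := by
  rw [weightSpace_quotient k Δ hb]
  -- The columns of the minor as functionals; they descend because the radical is killed by every
  -- `groundProj (u • ·)`.
  let φ : (RelaxedVerma k Δ π ⧸ groundKer k Δ π) →ₗ[ℂ] Fin r → ℂ :=
    LinearMap.pi fun t => ((groundKer k Δ π).restrictScalars ℂ).liftQ
      (β t ∘ₗ groundProj k Δ π ∘ₗ Algebra.lsmul ℂ ℂ (RelaxedVerma k Δ π) (c t).1) (by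
        intro v hv
        have h : groundProj k Δ π ((c t).1 • v) = 0 := hv _
        rw [LinearMap.mem_ker, LinearMap.comp_apply, LinearMap.comp_apply, Algebra.lsmul_coe, h,
          map_zero])
  refine le_finrank_span_range _ e φ ?_
  rw [← Polynomial.coe_evalRingHom, RingHom.map_det] at hdet
  convert hdet using 2
  ext s t
  change β t (groundProj k Δ π ((c t).1 • chainVec k Δ π b m (e s).1)) =
    (pairing k Δ q (e s).1 (c t)).eval (a + m * simpleRoot)
  rw [groundProj_smul_chainVec k Δ hb, specialise_apply, Finsupp.sum, map_sum]
  simp only [map_smul, hβ, smul_eq_mul, mul_ite, mul_one, mul_zero]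
  rw [Finset.sum_ite_eq']
  split_ifs with h
  · rfl
  · rw [Finsupp.notMem_support_iff] at h
    rw [pairing, h, Polynomial.eval_zero]

end Chains

open AffineSl2 Module
open UniversalEnvelopingAlgebra (ι)

/-! ### The dense module -/

section Dense

variable (k Δ : ℂ) (lam : Weight ⧸ rootLattice) (q : ℂ)

lemma coset_add_zmul {a : Weight} (ha : (a : Weight ⧸ rootLattice) = lam) (i : ℤ) :
    ((a + i * simpleRoot : Weight) : Weight ⧸ rootLattice) = lam := by
  rw [← ha]
  refine QuotientAddGroup.mk_add_of_mem a ?_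
  rw [← zsmul_eq_mul]
  exact AddSubgroup.zsmul_mem_zmultiples simpleRoot i

lemma exists_eq_add_of_coset {a ν : Weight} (ha : (a : Weight ⧸ rootLattice) = lam)
    (hν : (ν : Weight ⧸ rootLattice) = lam) : ∃ i : ℤ, ν = a + i * simpleRoot := by
  rw [← hν, QuotientAddGroup.eq] at ha
  obtain ⟨i, hi⟩ := AddSubgroup.mem_zmultiples_iff.mp ha
  refine ⟨i, ?_⟩
  rw [← zsmul_eq_mul, hi]
  ring

variable {lam}

/-- The basis of the dense module, indexed by the integers after the choice of a weight. -/
def denseVec {a : Weight} (ha : (a : Weight ⧸ rootLattice) = lam) (i : ℤ) : DenseSpace lam :=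
  Finsupp.single ⟨a + i * simpleRoot, coset_add_zmul lam ha i⟩ 1

lemma denseVec_weightChain {a : Weight} (ha : (a : Weight ⧸ rootLattice) = lam) :
    WeightChain q (denseRep lam q) a (denseVec ha) where
  span_eq_top := by
    rw [eq_top_iff]
    intro x _
    induction x using Finsupp.induction_linear with
    | zero => exact zero_mem _
    | add x y hx hy => exact add_mem (hx trivial) (hy trivial)
    | single ν c =>
      obtain ⟨i, hi⟩ := exists_eq_add_of_coset lam ha ν.2
      have h : Finsupp.single ν c = c • denseVec ha i := by
        rw [denseVec, Finsupp.smul_single, smul_eq_mul, mul_one]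
        congr 1
        exact Subtype.ext hi
      rw [h]
      exact Submodule.smul_mem _ c (Submodule.subset_span ⟨i, rfl⟩)
  map_h i := by
    rw [denseRep, sl2Rep_h, denseH, denseVec, Finsupp.linearCombination_single, one_smul]
    congr 1
    simp only [bilin, simpleRoot]
    ring
  map_e i := by
    rw [denseRep, sl2Rep_e, denseE, denseVec, Finsupp.linearCombination_single, one_smul, denseVec]
    congr 2
    refine Subtype.ext ?_
    simp only [CosetWeight.up]
    push_cast
    ring
  map_f i := by
    rw [denseRep, sl2Rep_f, denseF, denseVec, Finsupp.linearCombination_single, one_smul, denseVec]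
    congr 1
    refine Subtype.ext ?_
    simp only [CosetWeight.down]
    push_cast
    ring

/-! ### Injectivity of `e` and `f` on the dense module -/

lemma denseF_apply_down (x : DenseSpace lam) (μ : CosetWeight lam) :
    denseF lam x μ.down = x μ := by
  induction x using Finsupp.induction_linear with
  | zero => simp
  | add x y hx hy => simp only [map_add, Finsupp.add_apply, hx, hy]
  | single ν c =>
    rw [denseF, Finsupp.linearCombination_single, Finsupp.smul_apply, Finsupp.single_apply,
      Finsupp.single_apply]
    have h : ν.down = μ.down ↔ ν = μ := by
      simp only [CosetWeight.down, Subtype.ext_iff, sub_left_inj]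
    simp only [h]
    split_ifs <;> simp

lemma denseE_apply_up (x : DenseSpace lam) (μ : CosetWeight lam) :
    denseE lam q x μ.up = denseCoeff q μ.1 * x μ := by
  induction x using Finsupp.induction_linear with
  | zero => simp
  | add x y hx hy => simp only [map_add, Finsupp.add_apply, hx, hy, mul_add]
  | single ν c =>
    rw [denseE, Finsupp.linearCombination_single, Finsupp.smul_apply, Finsupp.smul_apply,
      Finsupp.single_apply, Finsupp.single_apply]
    have h : ν.up = μ.up ↔ ν = μ := by
      simp only [CosetWeight.up, Subtype.ext_iff, add_left_inj]
    simp only [h]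
    split_ifs with h
    · rw [h]; simp [mul_comm]
    · simp

lemma denseRep_f_injective : Function.Injective (denseRep lam q sl2f) := by
  rw [denseRep, sl2Rep_f]
  intro x y h
  ext μ
  rw [← denseF_apply_down x, h, denseF_apply_down]

/-- The coefficient `γ_μ` vanishes exactly at the solutions of `(μ, μ + 2ρ) = q`, and `lam` contains
none. -/
lemma denseRep_e_injective (hlam : lam ∉ nonsimpleSet q) :
    Function.Injective (denseRep lam q sl2e) := by
  rw [denseRep, sl2Rep_e]
  intro x y h
  ext μ
  have h1 := denseE_apply_up q x μ
  rw [h, denseE_apply_up] at h1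
  have h2 : denseCoeff q μ.1 ≠ 0 := by
    intro h0
    refine hlam ⟨μ.1, μ.2, ?_⟩
    rw [denseCoeff] at h0
    linear_combination (-2) * h0
  exact (mul_left_cancel₀ h2 h1).symm

end Dense

/-! ### The lowest-weight Verma module -/

section Lowest

variable (ν : Weight)

lemma lowestF_apply (x : LowestVermaSpace) (n : ℕ) :
    lowestF ν x n = (-(n + 1 : ℂ) * (ν + n)) * x (n + 1) := by
  induction x using Finsupp.induction_linear with
  | zero => simp
  | add x y hx hy => simp only [map_add, Finsupp.add_apply, hx, hy, mul_add]
  | single j c =>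
    rw [lowestF, Finsupp.linearCombination_single, Finsupp.smul_apply, Finsupp.smul_apply]
    cases j with
    | zero => simp
    | succ j =>
      rw [Nat.add_sub_cancel, Finsupp.single_apply, Finsupp.single_apply]
      by_cases h : j = n
      · subst h
        simp only [if_true, smul_eq_mul]
        push_cast
        ring
      · rw [if_neg h, if_neg (by omega)]
        simp

variable {ν}

/-- The lowest-weight Verma module is simple if no singular vector exists. -/
lemma lowestVermaRep_irreducible (hν : ∀ n : ℕ, ν + n ≠ 0) (P : Submodule ℂ LowestVermaSpace)
    (hP : ∀ x, ∀ m ∈ P, lowestVermaRep ν x m ∈ P) : P = ⊥ ∨ P = ⊤ := by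
  have hF (m) (hm : m ∈ P) : lowestF ν m ∈ P := by
    have := hP sl2f m hm
    rwa [lowestVermaRep, sl2Rep_f] at this
  have hE (m) (hm : m ∈ P) : lowestE m ∈ P := by
    have := hP sl2e m hm
    rwa [lowestVermaRep, sl2Rep_e] at this
  rw [or_iff_not_imp_left]
  intro hbot
  obtain ⟨m, hm, hm0⟩ := Submodule.exists_mem_ne_zero_of_ne_bot hbot
  -- Induction on the top index `d` of `m`: `f` lowers it by exactly one, since its coefficient
  -- there is nonzero.
  have h0 : ∀ (d : ℕ) (m : LowestVermaSpace), m ∈ P → (∀ j, d < j → m j = 0) → m d ≠ 0 →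
      Finsupp.single 0 1 ∈ P := by
    intro d
    induction d with
    | zero =>
      intro m hm hd hm0
      have : Finsupp.single 0 (1 : ℂ) = (m 0)⁻¹ • m := by
        ext j
        cases j with
        | zero => simp [hm0]
        | succ j => simp [hd (j + 1) (by omega)]
      rw [this]
      exact P.smul_mem _ hm
    | succ d ih =>
      intro m hm hd hmd
      refine ih (lowestF ν m) (hF m hm) (fun j hj => ?_) ?_
      · rw [lowestF_apply, hd (j + 1) (by omega), mul_zero]
      · rw [lowestF_apply]
        refine mul_ne_zero (mul_ne_zero ?_ (hν d)) hmd
        exact neg_ne_zero.mpr (by exact_mod_cast Nat.succ_ne_zero d)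
  have hs : m.support.Nonempty := Finsupp.support_nonempty_iff.mpr hm0
  have h1 : Finsupp.single 0 (1 : ℂ) ∈ P := by
    refine h0 (m.support.max' hs) m hm (fun j hj => ?_) ?_
    · by_contra hj0
      exact absurd (m.support.le_max' j (Finsupp.mem_support_iff.mpr hj0)) (by omega)
    · exact Finsupp.mem_support_iff.mp (m.support.max'_mem hs)
  have h2 (n : ℕ) : Finsupp.single n (1 : ℂ) ∈ P := by
    induction n with
    | zero => exact h1
    | succ n ih =>
      have := hE _ ih
      rwa [lowestE, Finsupp.linearCombination_single, one_smul] at this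
  rw [eq_top_iff]
  intro x _
  induction x using Finsupp.induction_linear with
  | zero => exact zero_mem _
  | add x y hx hy => exact add_mem (hx trivial) (hy trivial)
  | single n c => simpa using P.smul_mem c (h2 n)

/-- The normalisation of the basis of the lowest-weight Verma module for which `f` acts by
shifts. -/
def lowestNorm (ν : Weight) (n : ℕ) : ℂ := ∏ j ∈ Finset.range n, (-(j + 1 : ℂ) * (ν + j))

lemma lowestNorm_ne_zero (hν : ∀ n : ℕ, ν + n ≠ 0) (n : ℕ) : lowestNorm ν n ≠ 0 :=
  Finset.prod_ne_zero_iff.mpr fun j _ =>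
    mul_ne_zero (neg_ne_zero.mpr (by exact_mod_cast Nat.succ_ne_zero j)) (hν j)

lemma lowestNorm_succ (n : ℕ) :
    lowestNorm ν (n + 1) = lowestNorm ν n * (-(n + 1 : ℂ) * (ν + n)) :=
  Finset.prod_range_succ _ _

/-- The rescaled basis of the lowest-weight Verma module, extended by zero. -/
def lowestVec (ν : Weight) : ℤ → LowestVermaSpace
  -- Index `0` carries the weight `μ`, so the lowest weight `μ + α` sits at index `1`.
  | Int.ofNat 0 => 0
  | Int.ofNat (n + 1) => (lowestNorm ν n)⁻¹ • Finsupp.single n 1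
  | Int.negSucc _ => 0

lemma lowestVec_of_nonpos {i : ℤ} (hi : i ≤ 0) : lowestVec ν i = 0 := by
  match i, hi with
  | Int.ofNat 0, _ => rfl
  | Int.ofNat (n + 1), h => exact absurd h (by simp)
  | Int.negSucc n, _ => rfl

lemma lowestVec_succ (n : ℕ) :
    lowestVec ν (n + 1 : ℤ) = (lowestNorm ν n)⁻¹ • Finsupp.single n 1 := rfl

/-- The lowest-weight Verma module behaves like the upper part of a dense module of parameter `q`,
cut off at the zero `μ` of `γ`. -/
lemma lowestVec_weightChain {q : ℂ} {μ : Weight} (hμ : bilin μ (μ + 2 * weylVector) = q)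
    (hν : ∀ n : ℕ, (μ + simpleRoot) + n ≠ 0) :
    WeightChain q (lowestVermaRep (μ + simpleRoot)) μ (lowestVec (μ + simpleRoot)) := by
  have hcases (i : ℤ) : i ≤ 0 ∨ ∃ n : ℕ, i = n + 1 := by
    rcases le_or_gt i 0 with h | h
    · exact Or.inl h
    · exact Or.inr ⟨(i - 1).toNat, by omega⟩
  refine ⟨?_, fun i => ?_, fun i => ?_, fun i => ?_⟩
  · rw [eq_top_iff]
    intro x _
    induction x using Finsupp.induction_linear with
    | zero => exact zero_mem _
    | add x y hx hy => exact add_mem (hx trivial) (hy trivial)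
    | single n c =>
      have h1 : lowestVec (μ + simpleRoot) (n + 1 : ℤ) ∈
          Submodule.span ℂ (Set.range (lowestVec (μ + simpleRoot))) :=
        Submodule.subset_span ⟨_, rfl⟩
      have h2 := Submodule.smul_mem _ (c * lowestNorm (μ + simpleRoot) n) h1
      rw [lowestVec_succ, smul_smul, mul_assoc, mul_inv_cancel₀ (lowestNorm_ne_zero hν n)] at h2
      simpa using h2
  · rcases hcases i with h | ⟨n, rfl⟩
    · rw [lowestVec_of_nonpos h]; simp
    · rw [lowestVermaRep, sl2Rep_h, lowestVec_succ, map_smul, lowestH,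
        Finsupp.linearCombination_single, one_smul, smul_comm]
      congr 1
      push_cast
      ring
  · rcases hcases i with h | ⟨n, rfl⟩
    · rw [lowestVec_of_nonpos h, map_zero]
      rcases h.lt_or_eq with h | rfl
      · rw [lowestVec_of_nonpos (by omega), smul_zero]
      -- The one place where `b i = 0` but `b (i + 1) ≠ 0`: the dense formula survives because `γ_μ
      -- = 0`.
      · have : denseCoeff q (μ + (0 : ℤ) * simpleRoot) = 0 := by
          rw [denseCoeff, ← hμ]; simp
        rw [this, zero_smul]
    · have e : ((n : ℤ) + 1 + 1) = ((n + 1 : ℕ) : ℤ) + 1 := by push_cast; ring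
      rw [lowestVermaRep, sl2Rep_e, lowestVec_succ, map_smul, lowestE,
        Finsupp.linearCombination_single, one_smul, e, lowestVec_succ, smul_smul]
      congr 1
      have h1 := lowestNorm_ne_zero hν n
      have h2 := lowestNorm_ne_zero hν (n + 1)
      rw [inv_eq_iff_eq_inv, mul_inv, inv_inv]
      rw [lowestNorm_succ] at h2 ⊢
      have h3 : -(n + 1 : ℂ) * (μ + simpleRoot + n) ≠ 0 := right_ne_zero_of_mul h2
      have h4 : denseCoeff q (μ + ((n + 1 : ℤ) : ℂ) * simpleRoot) =
          -(n + 1 : ℂ) * (μ + simpleRoot + n) := by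
        rw [denseCoeff, ← hμ]
        simp only [bilin, weylVector, simpleRoot]
        push_cast
        ring
      rw [h4, mul_comm, mul_assoc, mul_inv_cancel₀ h3, mul_one]
  · rcases hcases i with h | ⟨n, rfl⟩
    · rw [lowestVec_of_nonpos h, lowestVec_of_nonpos (by omega), map_zero]
    · rw [lowestVermaRep, sl2Rep_f, lowestVec_succ, map_smul, lowestF,
        Finsupp.linearCombination_single, one_smul, smul_smul]
      cases n with
      | zero => rw [lowestVec_of_nonpos (by simp)]; simp
      | succ n =>
        have e : (((n + 1 : ℕ) : ℤ) + 1 - 1) = (n : ℤ) + 1 := by push_cast; ring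
        rw [e, lowestVec_succ, Nat.add_sub_cancel]
        congr 1
        have h2 := lowestNorm_ne_zero hν (n + 1)
        rw [lowestNorm_succ] at h2 ⊢
        have h3 : -(n + 1 : ℂ) * (μ + simpleRoot + n) ≠ 0 := right_ne_zero_of_mul h2
        rw [mul_inv, mul_assoc]
        have h4 : -((n + 1 : ℕ) : ℂ) * (μ + simpleRoot + ((n + 1 : ℕ) : ℂ) - 1) =
            -(n + 1 : ℂ) * (μ + simpleRoot + n) := by push_cast; ring
        rw [h4, inv_mul_cancel₀ h3, mul_one]

end Lowest

/-! ### Weight multiplicities -/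

section Multiplicities

variable (k Δ q : ℂ) {lam : Weight ⧸ rootLattice}

/-- The mode `x₀` shifts the weight by `c`, commutes with `L₀`, and inherits injectivity on the
quotient from the ground states through the Ore argument. -/
lemma finrank_weightSpace_le_of_injective {M : Type*} [AddCommGroup M] [Module ℂ M]
    {π : Sl2 →ₗ⁅ℂ⁆ Module.End ℂ M} {x : Sl2} {c : ℂ} (hx : ⁅sl2h, x⁆ = c • x)
    (hx3 : ∀ y : Sl2, ⁅x, ⁅x, ⁅x, y⁆⁆⁆ = 0) (hinj : Function.Injective (π x)) (ν n : ℂ)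
    [FiniteDimensional ℂ (weightSpace (RelaxedVerma k Δ π ⧸ groundKer k Δ π) (ν + c) n)] :
    finrank ℂ (weightSpace (RelaxedVerma k Δ π ⧸ groundKer k Δ π) ν n) ≤
      finrank ℂ (weightSpace (RelaxedVerma k Δ π ⧸ groundKer k Δ π) (ν + c) n) := by
  set Q := RelaxedVerma k Δ π ⧸ groundKer k Δ π
  have h1 : act Q (mode sl2h 0) * act Q (mode x 0) =
      act Q (mode x 0) * act Q (mode sl2h 0) + c • act Q (mode x 0) := by
    refine LinearMap.ext fun v => ?_
    change ι ℂ (mode sl2h 0) • ι ℂ (mode x 0) • v =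
      ι ℂ (mode x 0) • ι ℂ (mode sl2h 0) • v + c • ι ℂ (mode x 0) • v
    rw [ι_smul_comm, mode_lie_mode, hx, ← modeMap_apply _ (c • x), map_smul, modeMap_apply]
    simp
  have h2 : act Q L0 * act Q (mode x 0) =
      act Q (mode x 0) * act Q L0 + (0 : ℂ) • act Q (mode x 0) := by
    refine LinearMap.ext fun v => ?_
    change ι ℂ L0 • ι ℂ (mode x 0) • v =
      ι ℂ (mode x 0) • ι ℂ L0 • v + (0 : ℂ) • ι ℂ (mode x 0) • v
    rw [ι_smul_comm, L0_lie_mode]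
    simp
  have hmaps : ∀ v ∈ weightSpace Q ν n, act Q (mode x 0) v ∈ weightSpace Q (ν + c) n := by
    rintro v ⟨hv1, hv2⟩
    refine ⟨mem_maxGenEigenspace_of_commutator h1 hv1, ?_⟩
    simpa using mem_maxGenEigenspace_of_commutator h2 hv2
  have hker : Function.Injective (act Q (mode x 0)) := by
    rw [← LinearMap.ker_eq_bot, eq_bot_iff]
    intro v hv
    induction v using Submodule.Quotient.induction_on with
    | H v =>
      have hv' : (groundKer k Δ π).mkQ (ι ℂ (mode x 0) • v) = 0 := hv
      rw [← LinearMap.mem_ker, Submodule.ker_mkQ] at hv'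
      have := mem_groundKer_of_mode_zero_smul_mem k Δ π (ad_mode_zero_pow_eq_zero hx3) hinj hv'
      rw [← Submodule.ker_mkQ (groundKer k Δ π)] at this
      exact this
  exact LinearMap.finrank_le_finrank_of_injective (f := (act Q (mode x 0)).restrict hmaps)
    fun v w h => Subtype.ext (hker (congrArg Subtype.val h))

/-- Adjacent weight spaces embed into each other by `e₀` and `f₀`; as they are finite-dimensional,
their dimensions agree. -/
lemma finrank_weightSpace_dense_add (hlam : lam ∉ nonsimpleSet q) {a : Weight}
    (ha : (a : Weight ⧸ rootLattice) = lam) (n : ℂ) (m : ℤ) :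
    finrank ℂ (weightSpace (RelaxedVerma k Δ (denseRep lam q) ⧸ groundKer k Δ (denseRep lam q))
      (a + m * simpleRoot) n) =
    finrank ℂ (weightSpace (RelaxedVerma k Δ (denseRep lam q) ⧸ groundKer k Δ (denseRep lam q))
      a n) := by
  have hfd := finiteDimensional_weightSpace_quotient k Δ (denseVec_weightChain q ha)
    (groundKer k Δ (denseRep lam q))
  obtain ⟨h1, -, h3⟩ := sl2_relations
  have hstep (ν : Weight) :
      finrank ℂ (weightSpace (RelaxedVerma k Δ (denseRep lam q) ⧸ groundKer k Δ (denseRep lam q))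
        (ν + simpleRoot) n) =
      finrank ℂ (weightSpace (RelaxedVerma k Δ (denseRep lam q) ⧸ groundKer k Δ (denseRep lam q))
        ν n) := by
    apply le_antisymm
    · have := hfd (ν + simpleRoot + -2) n
      have h := finrank_weightSpace_le_of_injective k Δ h3 sl2f_ad_nilpotent
        (denseRep_f_injective q (lam := lam)) (ν + simpleRoot) n
      have e : ν + simpleRoot + -2 = ν := by simp only [simpleRoot]; ring
      rwa [e] at h
    · have := hfd (ν + 2) n
      exact finrank_weightSpace_le_of_injective k Δ h1 sl2e_ad_nilpotent
        (denseRep_e_injective q hlam) ν n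
  induction m using Int.induction_on with
  | zero => rw [show a + ((0 : ℤ) : ℂ) * simpleRoot = a by simp]
  | succ m ih =>
    have e : a + ((m + 1 : ℤ) : ℂ) * simpleRoot = a + ((m : ℤ) : ℂ) * simpleRoot + simpleRoot := by
      push_cast; ring
    rw [e, hstep, ih]
  | pred m ih =>
    have e : a + ((-m : ℤ) : ℂ) * simpleRoot =
        a + ((-m - 1 : ℤ) : ℂ) * simpleRoot + simpleRoot := by
      push_cast; ring
    rw [← hstep, ← e, ih]

lemma finite_eval_eq_zero {p : Polynomial ℂ} (hp : p ≠ 0) (a : ℂ) :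
    {m : ℤ | p.eval (a + m * simpleRoot) = 0}.Finite := by
  have hinj : Function.Injective fun m : ℤ => a + (m : ℂ) * simpleRoot := by
    intro m m' h
    have : (m : ℂ) * 2 = m' * 2 := add_left_cancel h
    exact_mod_cast mul_right_cancel₀ two_ne_zero this
  refine ((p.rootSet_finite ℂ).preimage hinj.injOn).subset ?_
  intro m hm
  simpa [Polynomial.mem_rootSet, hp] using hm

end Multiplicities

open AffineSl2

/-! ### Comparison of the string functions -/

section Comparison

variable {k Δ q : ℂ} {d r : ℕ} {e : Fin r → {l : List (Fin 3 × ℕ) // wordDeg l = d}}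
  {c : Fin r → UAffine × ℤ}

/-- The minor may vanish at `a` itself, but not along the whole coset; constancy of multiplicities
moves the count to a good weight. All columns are visible there because the `v_μ` form a basis. -/
lemma finrank_weightSpace_dense {lam : Weight ⧸ rootLattice} (hlam : lam ∉ nonsimpleSet q)
    (hdet : (Matrix.of fun s t => pairing k Δ q (e s).1 (c t)).det ≠ 0)
    (hle : ∀ a : ℂ, Module.finrank ℂ (Submodule.span ℂ (Set.range
      fun (l : {l : List (Fin 3 × ℕ) // wordDeg l = d}) c => (pairing k Δ q l.1 c).eval a)) ≤ r)
    {a : Weight} (ha : (a : Weight ⧸ rootLattice) = lam) :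
    Module.finrank ℂ
      (weightSpace (RelaxedVerma k Δ (denseRep lam q) ⧸ groundKer k Δ (denseRep lam q)) a (Δ + d)) = r := by
  have hb := denseVec_weightChain q ha
  obtain ⟨m, hm⟩ := (finite_eval_eq_zero hdet a).exists_notMem
  rw [← finrank_weightSpace_dense_add k Δ q hlam ha _ m]
  refine le_antisymm ((finrank_weightSpace_le k Δ hb m d).trans (hle _)) ?_
  refine le_finrank_weightSpace k Δ hb m d r e c hm
    (fun t => Finsupp.lapply ⟨_, coset_add_zmul lam ha (m + (c t).2)⟩) fun t i => ?_
  rw [Finsupp.lapply_apply, denseVec, Finsupp.single_apply]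
  refine if_congr ?_ rfl rfl
  rw [Subtype.mk.injEq]
  constructor
  · intro h
    have h1 : (((m + i : ℤ) : ℂ)) * 2 = ((m + (c t).2 : ℤ) : ℂ) * 2 := add_left_cancel h
    have h2 : m + i = m + (c t).2 := by exact_mod_cast mul_right_cancel₀ two_ne_zero h1
    omega
  · rintro rfl
    rfl

/-- Two conditions hold for large `m`: the minor is nonzero, and the finitely many ground indices
used by its columns are positive, where the ground vectors are nonzero. -/
lemma finrank_weightSpace_lowest {μ : Weight} (hμ : bilin μ (μ + 2 * weylVector) = q)
    (hν : ∀ n : ℕ, (μ + simpleRoot) + n ≠ 0)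
    (hdet : (Matrix.of fun s t => pairing k Δ q (e s).1 (c t)).det ≠ 0)
    (hle : ∀ a : ℂ, Module.finrank ℂ (Submodule.span ℂ (Set.range
      fun (l : {l : List (Fin 3 × ℕ) // wordDeg l = d}) c => (pairing k Δ q l.1 c).eval a)) ≤ r) :
    ∀ᶠ m : ℤ in atTop, Module.finrank ℂ (weightSpace
      (RelaxedVerma k Δ (lowestVermaRep (μ + simpleRoot)) ⧸
      groundKer k Δ (lowestVermaRep (μ + simpleRoot))) (μ + m * simpleRoot) (Δ + d)) = r := by
  have hb := lowestVec_weightChain hμ hν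
  have h1 : ∀ᶠ m : ℤ in atTop, ∀ t, 1 - (c t).2 ≤ m :=
    eventually_all.mpr fun t => eventually_ge_atTop _
  have h2 : ∀ᶠ m : ℤ in atTop, (Matrix.of fun s t => pairing k Δ q (e s).1 (c t)).det.eval
      (μ + m * simpleRoot) ≠ 0 := by
    obtain ⟨B, hB⟩ := (finite_eval_eq_zero hdet μ).bddAbove
    filter_upwards [eventually_gt_atTop B] with m hm h0
    exact absurd (hB h0) (not_le.mpr hm)
  filter_upwards [h1, h2] with m hm hm'
  refine le_antisymm ((finrank_weightSpace_le k Δ hb m d).trans (hle _)) ?_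
  refine le_finrank_weightSpace k Δ hb m d r e c hm'
    -- The functional dual to `lowestVec` at index `m + (c t).2`: coordinate one lower, with the
    -- normalisation undone.
    (fun t => lowestNorm (μ + simpleRoot) (m + (c t).2 - 1).toNat •
      Finsupp.lapply (m + (c t).2 - 1).toNat) fun t i => ?_
  have ht := hm t
  rcases le_or_gt (m + i) 0 with h | h
  · rw [lowestVec_of_nonpos h, map_zero, if_neg (by omega)]
  · obtain ⟨n, hn⟩ : ∃ n : ℕ, m + i = n + 1 := ⟨(m + i - 1).toNat, by omega⟩
    rw [hn, lowestVec_succ, LinearMap.smul_apply, map_smul, Finsupp.lapply_apply,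
      Finsupp.single_apply]
    by_cases hi : i = (c t).2
    · have hn' : n = (m + (c t).2 - 1).toNat := by omega
      rw [if_pos hn', if_pos hi, ← hn', smul_eq_mul, smul_eq_mul, mul_one,
        mul_inv_cancel₀ (lowestNorm_ne_zero hν n)]
    · rw [if_neg (by omega), if_neg hi, smul_zero, smul_zero]

/-- The two solutions sum to `-2`. If `μ = -n - 2`, then `1 + 2q = (n + 1)²` and `n` is a larger
solution, against maximality. -/
lemma add_natCast_ne_zero {μ : Weight} (hμ : bilin μ (μ + 2 * weylVector) = q)
    (hmax : (∃ n : ℤ, (n : ℂ) ^ 2 = 1 + 2 * q) →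
      ∀ μ' : Weight, bilin μ' (μ' + 2 * weylVector) = q → μ'.re ≤ μ.re) (n : ℕ) :
    (μ + simpleRoot) + n ≠ 0 := by
  intro h
  simp only [bilin, weylVector, simpleRoot] at hμ hmax h
  have hμn : μ = -(n : ℂ) - 2 := by linear_combination h
  have h1 := hmax ⟨n + 1, by rw [← hμ, hμn]; push_cast; ring⟩ n (by rw [← hμ, hμn]; ring)
  rw [hμn] at h1
  simp only [Complex.natCast_re, Complex.sub_re, Complex.neg_re, Complex.re_ofNat] at h1
  have : (0 : ℝ) ≤ n := Nat.cast_nonneg n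
  linarith

/-- The ground state `v_a` survives in the quotient, being its own ground component. -/
lemma weightSpace_dense_ne_bot {lam : Weight ⧸ rootLattice} {a : Weight}
    (ha : (a : Weight ⧸ rootLattice) = lam) :
    weightSpace (RelaxedVerma k Δ (denseRep lam q) ⧸ groundKer k Δ (denseRep lam q)) a Δ ≠ ⊥ := by
  have h := weightSpace_quotient k Δ (denseVec_weightChain q ha) (groundKer k Δ (denseRep lam q)) 0 0
  have e1 : a + ((0 : ℤ) : ℂ) * simpleRoot = a := by simp
  have e2 : Δ + ((0 : ℕ) : ℂ) = Δ := by simp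
  rw [e1, e2] at h
  rw [h]
  intro hbot
  have h0 : (groundKer k Δ (denseRep lam q)).mkQ (chainVec k Δ _ (denseVec ha) 0 []) = 0 := by
    rw [← Submodule.mem_bot ℂ, ← hbot]
    exact Submodule.subset_span ⟨⟨[], rfl⟩, rfl⟩
  rw [← LinearMap.mem_ker, Submodule.ker_mkQ] at h0
  have h1 := h0 1
  rw [one_smul, chainVec, wordElt, one_smul, groundProj_mk, denseVec, Finsupp.single_eq_zero] at h1
  exact one_ne_zero h1

end Comparison

end RelaxedSl2

end

/-! ### The main theorem -/

open RelaxedSl2 in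
theorem mainTheorem1 (k Δ q : ℂ) (lam : Weight ⧸ rootLattice) (hlam : lam ∉ nonsimpleSet q)
    (μ : Weight) (hμ : bilin μ (μ + 2 * weylVector) = q)
    (hmax : (∃ n : ℤ, (n : ℂ) ^ 2 = 1 + 2 * q) →
      ∀ μ' : Weight, bilin μ' (μ' + 2 * weylVector) = q → μ'.re ≤ μ.re) :
    (∀ (ν : Weight) (n : ℂ),
      FiniteDimensional ℂ (weightSpace (RelaxedModule k Δ lam q) ν n) ∧
      FiniteDimensional ℂ (weightSpace (SimpleLowest k Δ (μ + simpleRoot)) ν n)) ∧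
    (∀ ν : Weight, stringFunction (RelaxedModule k Δ lam q) ν ≠ 0 ↔
      (ν : Weight ⧸ rootLattice) = lam) ∧
    (∀ ν : Weight, (ν : Weight ⧸ rootLattice) = lam →
      IsPositiveLimit (SimpleLowest k Δ (μ + simpleRoot)) μ
        (stringFunction (RelaxedModule k Δ lam q) ν)) := by
  obtain ⟨a, ha⟩ := QuotientAddGroup.mk_surjective lam
  have hν := add_natCast_ne_zero hμ hmax
  have hbL := lowestVec_weightChain hμ hν
  have hbE := denseVec_weightChain q ha
  unfold RelaxedModule SimpleLowest
  rw [maxAvoidingGround_eq, maxProper_eq k Δ _ (lowestVermaRep_irreducible hν)]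
  have hfin := finiteDimensional_weightSpace_quotient k Δ hbE (groundKer k Δ (denseRep lam q))
  refine ⟨fun ν n => ⟨hfin ν n, finiteDimensional_weightSpace_quotient k Δ hbL _ ν n⟩,
    fun ν => ⟨fun h => ?_, fun h h0 => ?_⟩, fun ν hνlam n => ?_⟩
  · by_contra hne
    refine h (funext fun n => ?_)
    rw [stringFunction, weightSpace_quotient_eq_bot k Δ hbE]
    · exact finrank_bot ℂ _
    · rintro m - rfl
      exact absurd (coset_add_zmul lam ha m) hne
  · have := hfin ν Δ
    exact weightSpace_dense_ne_bot h (Submodule.finrank_eq_zero.mp (congrFun h0 Δ))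
  · by_cases hn : ∃ d : ℕ, n = Δ + d
    · obtain ⟨d, rfl⟩ := hn
      -- One generic rank and one minor, depending only on `k`, `Δ`, `q` and `d`, serve both
      -- modules.
      obtain ⟨r, e, c, hdet, hle⟩ := exists_generic_rank
        fun (l : {l : List (Fin 3 × ℕ) // wordDeg l = d}) c => pairing k Δ q l.1 c
      refine tendsto_nhds_of_eventually_eq ?_
      filter_upwards [finrank_weightSpace_lowest hμ hν hdet hle] with m hm
      rw [stringFunction, stringFunction, hm, finrank_weightSpace_dense hlam hdet hle hνlam]
    -- Outside `Δ + ℕ` both modules have no weight vectors.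
    · push Not at hn
      have h1 : stringFunction (RelaxedVerma k Δ (denseRep lam q) ⧸ groundKer k Δ (denseRep lam q))
          ν n = 0 := by
        rw [stringFunction, weightSpace_quotient_eq_bot k Δ hbE _ fun m d _ => hn d]
        exact finrank_bot ℂ _
      rw [h1]
      refine tendsto_nhds_of_eventually_eq (Eventually.of_forall fun m => ?_)
      rw [stringFunction, weightSpace_quotient_eq_bot k Δ hbL _ fun m d _ => hn d]
      exact finrank_bot ℂ _
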